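/- Let $A,B$ be $n\times n$ complex positive definite matrices. For an $n\times n$ matrix $X$ let $\lambda(X)$ and $s(X)$ be the $n$-tuples of its eigenvalues (with algebraic multiplicity) and of its singular values, and let $A\#_tB=A^{1/2}(A^{-1/2}BA^{-1/2})^tA^{1/2}$. For $x,y\in\mathbb R^n$ with nonnegative components, and $x^\downarrow$ the decreasing rearrangement of $x$, write $x\prec_{\log}y$ if $\prod_{j=1}^k x_j^\downarrow\le\prod_{j=1}^k y_j^\downarrow$ for $1\le k\le n$, with equality for $k=n$, and write $x\le y$ if $x_j^\downarrow\le y_j^\downarrow$ for all $j$. Powers of tuples are taken componentwise. For $0\le t\le 1$ the eigenvalues of $A\#_tB$, of $A^{1-t}B^t$, of $(1-t)A+tB$ and, if $t>0$, of $A^{\frac{1-t}{2t}}BA^{\frac{1-t}{2t}}$ are positive real numbers, and the following hold. (i) For $\tfrac12\le t\le 1$: $$\lambda(A\#_tB)\prec_{\log}\lambda(A^{1-t}B^t)\prec_{\log}\lambda\big(A^{\frac{1-t}{2t}}BA^{\frac{1-t}{2t}}\big)^t\prec_{\log}s(A^{1-t}B^t)\le\lambda((1-t)A+tB).$$ (ii)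 For $0\le t\le\tfrac12$: $$\lambda(A\#_tB)\prec_{\log}\lambda(A^{1-t}B^t)\prec_{\log}s(A^{1-t}B^t)\prec_{\log}\lambda\big(A^{\frac{1-t}{2t}}BA^{\frac{1-t}{2t}}\big)^t,$$ where at $t=0$ the last term is understood as $\lambda(G)$ with $G=\lim_{t\to0^+}\big(A^{\frac{1-t}{2t}}BA^{\frac{1-t}{2t}}\big)^t$; this limit exists and its eigenvalues are positive real numbers. -/

import Mathlib

open scoped MatrixOrder ComplexOrder Topology

namespace MatrixChain

noncomputable section

/-- The components of a real `n`-vector arranged in decreasing order. -/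
def decr {n : ℕ} (x : Fin n → ℝ) : Fin n → ℝ :=
  fun i => x (Tuple.sort (fun j => -x j) i)

theorem decr_antitone {n : ℕ} (x : Fin n → ℝ) : Antitone (decr x) := by
  intro i j hij
  have h := Tuple.monotone_sort (fun j => -x j) hij
  simpa [decr] using h

theorem decr_perm {n : ℕ} (x : Fin n → ℝ) : ∃ σ : Equiv.Perm (Fin n), decr x = x ∘ σ :=
  ⟨Tuple.sort (fun j => -x j), rfl⟩

/-- The product of the `k` largest components of `x`, for `k ≤ n`. -/
def topProd {n : ℕ} (x : Fin n → ℝ) (k : ℕ) : ℝ :=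
  ∏ i : Fin n with i.val < k, decr x i

/-- Weak log majorization `x ≺_wlog y` of vectors with nonnegative components. -/
def WeakLogMaj {n : ℕ} (x y : Fin n → ℝ) : Prop :=
  (∀ i, 0 ≤ x i) ∧ (∀ i, 0 ≤ y i) ∧ ∀ k : ℕ, 1 ≤ k → k ≤ n → topProd x k ≤ topProd y k

/-- Log majorization `x ≺_log y` of vectors with nonnegative components. -/
def LogMaj {n : ℕ} (x y : Fin n → ℝ) : Prop :=
  WeakLogMaj x y ∧ topProd x n = topProd y n

/-- The order `x ≤ y` between decreasing rearrangements. -/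
def DecrLE {n : ℕ} (x y : Fin n → ℝ) : Prop :=
  ∀ j, decr x j ≤ decr y j

theorem card_roots_charpoly {n : ℕ} (X : Matrix (Fin n) (Fin n) ℂ) :
    X.charpoly.roots.toList.length = n := by
  rw [Multiset.length_toList, IsAlgClosed.card_roots_eq_natDegree,
    Matrix.charpoly_natDegree_eq_dim, Fintype.card_fin]

/-- The `n`-tuple of (complex) eigenvalues of an arbitrary `n × n` matrix, counted with algebraic
multiplicity, in an arbitrary order. -/
def eig {n : ℕ} (X : Matrix (Fin n) (Fin n) ℂ) : Fin n → ℂ :=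
  fun i => X.charpoly.roots.toList.get (i.cast (card_roots_charpoly X).symm)

theorem map_eig {n : ℕ} (X : Matrix (Fin n) (Fin n) ℂ) :
    Finset.univ.val.map (eig X) = X.charpoly.roots := by
  have h : List.ofFn (eig X) = X.charpoly.roots.toList := by
    apply List.ext_get
    · simpa using (card_roots_charpoly X).symm
    · intro i h1 h2
      simp [eig]
  rw [Fin.univ_val_map, h, Multiset.coe_toList]

/-- All eigenvalues of `X` are positive real numbers. -/
def HasPosEig {n : ℕ} (X : Matrix (Fin n) (Fin n) ℂ) : Prop :=
  ∀ i, (eig X i).im = 0 ∧ 0 < (eig X i).re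

/-- The eigenvalue tuple as a real vector, meant for matrices with real eigenvalues. -/
def lam {n : ℕ} (X : Matrix (Fin n) (Fin n) ℂ) : Fin n → ℝ :=
  fun i => (eig X i).re

/-- The tuple of singular values `s_1(X) ≥ ... ≥ s_n(X)`. -/
def sing {n : ℕ} (X : Matrix (Fin n) (Fin n) ℂ) : Fin n → ℝ :=
  fun i => (Matrix.toEuclideanLin X).singularValues i

/-- The weighted geometric mean `A #_t B`. -/
def gmean {n : ℕ} (t : ℝ) (A B : Matrix (Fin n) (Fin n) ℂ) : Matrix (Fin n) (Fin n) ℂ :=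
  A ^ (1 / 2 : ℝ) * (A ^ (-(1 / 2) : ℝ) * B * A ^ (-(1 / 2) : ℝ)) ^ t * A ^ (1 / 2 : ℝ)

/-- The sandwiched matrix `A ^ ((1-t)/2t) B A ^ ((1-t)/2t)`, for `t ≠ 0`. -/
def sandwich {n : ℕ} (t : ℝ) (A B : Matrix (Fin n) (Fin n) ℂ) : Matrix (Fin n) (Fin n) ℂ :=
  A ^ ((1 - t) / (2 * t)) * B * A ^ ((1 - t) / (2 * t))

end

end MatrixChain

/-! Every log-majorization here reduces to comparing top eigenvalues. The product of the `k` largest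
eigenvalues of a positive definite `M` is the largest eigenvalue of its `k`-th compound, so it is at
most `c` exactly when `compound k M ≤ c • 1` (`topProd_lam_le_iff`). Compounds are multiplicative
(Cauchy-Binet) and commute with real powers, so an implication "one expression in `A`, `B` is `≤ c •
1`, hence so is another" gives all `k` at once when applied to the compounds. Equality at `k = n` is
a determinant computation. The non-Hermitian `A ^ (1 - t) * B ^ t` shares its characteristic
polynomial with a Hermitian sandwich, and singular values are square roots of eigenvalues of such
sandwiches.

Two operator inequalities supply the implications, both resting on Löwner-Heinz monotonicity.
`araki` gives all links between products, sandwiches and singular values; which exponent is at most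
one decides the direction, hence the split at `t = 1/2`. `geomMean_le_of_le_half`, from Furuta's
inequality, gives the link with the geometric mean, and the symmetry `geomMean_comm` carries it to
`t ≥ 1/2`.

The last link of (i) is Ando's Young inequality (`decrLE_young`): a dimension count yields a unit
vector adapted to both spectra, on which Jensen's inequality reduces the claim to weighted AM-GM.
The limit at `t = 0` is `A`, by squeezing `B` between positive scalars. -/

namespace MatrixChain

open Matrix

/-! ### Real powers of positive definite matrices through unitary diagonalization. -/

section Powers

variable {N : Type*} [Fintype N]

/-- Conjugation by a Hermitian matrix is monotone. -/
theorem conj_le_conj {A B C : Matrix N N ℂ} (hC : star C = C) (h : A ≤ B) :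
    C * A * C ≤ C * B * C := by
  simpa [hC] using star_left_conjugate_le_conjugate h C

variable [DecidableEq N]

/-- The matrix `U * diag(d) * Uᴴ`. -/
noncomputable def conjDiag (U : Matrix N N ℂ) (d : N → ℝ) : Matrix N N ℂ :=
  U * diagonal (fun i => (d i : ℂ)) * star U

theorem exists_eq_conjDiag {A : Matrix N N ℂ} (hA : A.IsHermitian) :
    ∃ U ∈ unitaryGroup N ℂ, A = conjDiag U hA.eigenvalues := by
  refine ⟨hA.eigenvectorUnitary, hA.eigenvectorUnitary.2, ?_⟩
  conv_lhs => rw [hA.spectral_theorem, Unitary.conjStarAlgAut_apply]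
  rfl

theorem exists_eq_conjDiag_pos {A : Matrix N N ℂ} (hA : A.PosDef) :
    ∃ U ∈ unitaryGroup N ℂ, ∃ d : N → ℝ, (∀ i, 0 < d i) ∧ A = conjDiag U d := by
  obtain ⟨U, hU, h⟩ := exists_eq_conjDiag hA.isHermitian
  exact ⟨U, hU, _, hA.eigenvalues_pos, h⟩

theorem conjDiag_mul {U : Matrix N N ℂ} (hU : U ∈ unitaryGroup N ℂ) (d e : N → ℝ) :
    conjDiag U d * conjDiag U e = conjDiag U (fun i => d i * e i) := by
  have h := mem_unitaryGroup_iff'.1 hU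
  calc conjDiag U d * conjDiag U e
      = U * diagonal (fun i => (d i : ℂ)) * (star U * U) * diagonal (fun i => (e i : ℂ))
        * star U := by simp only [conjDiag, Matrix.mul_assoc]
    _ = _ := by rw [h]; simp [conjDiag, Matrix.mul_assoc]

theorem conjDiag_const {U : Matrix N N ℂ} (hU : U ∈ unitaryGroup N ℂ) (c : ℝ) :
    conjDiag U (fun _ => c) = c • (1 : Matrix N N ℂ) := by
  have h := mem_unitaryGroup_iff.1 hU
  have : diagonal (fun _ : N => (c : ℂ)) = c • (1 : Matrix N N ℂ) := by
    ext i j; by_cases hij : i = j <;> simp [hij]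
  rw [conjDiag, this, Matrix.mul_smul, Matrix.mul_one, Matrix.smul_mul, h]

theorem conjDiag_sub (U : Matrix N N ℂ) (d e : N → ℝ) :
    conjDiag U d - conjDiag U e = conjDiag U (fun i => d i - e i) := by
  simp [conjDiag, ← Matrix.sub_mul, ← Matrix.mul_sub]

theorem posSemidef_conjDiag_iff {U : Matrix N N ℂ} (hU : U ∈ unitaryGroup N ℂ) (d : N → ℝ) :
    (conjDiag U d).PosSemidef ↔ ∀ i, 0 ≤ d i := by
  have h : IsUnit U := ⟨⟨U, star U, mem_unitaryGroup_iff.1 hU, mem_unitaryGroup_iff'.1 hU⟩, rfl⟩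
  rw [conjDiag, h.posSemidef_star_right_conjugate_iff, posSemidef_diagonal_iff]
  simp

theorem posDef_conjDiag_iff {U : Matrix N N ℂ} (hU : U ∈ unitaryGroup N ℂ) (d : N → ℝ) :
    (conjDiag U d).PosDef ↔ ∀ i, 0 < d i := by
  have h : IsUnit U := ⟨⟨U, star U, mem_unitaryGroup_iff.1 hU, mem_unitaryGroup_iff'.1 hU⟩, rfl⟩
  rw [conjDiag, h.posDef_star_right_conjugate_iff, posDef_diagonal_iff]
  simp

theorem conjDiag_le_iff {U : Matrix N N ℂ} (hU : U ∈ unitaryGroup N ℂ) (d e : N → ℝ) :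
    conjDiag U d ≤ conjDiag U e ↔ ∀ i, d i ≤ e i := by
  rw [Matrix.le_iff, conjDiag_sub, posSemidef_conjDiag_iff hU]
  simp

theorem conjDiag_le_smul_one_iff {U : Matrix N N ℂ} (hU : U ∈ unitaryGroup N ℂ) (d : N → ℝ)
    (c : ℝ) : conjDiag U d ≤ c • 1 ↔ ∀ i, d i ≤ c := by
  rw [← conjDiag_const hU, conjDiag_le_iff hU]

theorem smul_one_le_conjDiag_iff {U : Matrix N N ℂ} (hU : U ∈ unitaryGroup N ℂ) (d : N → ℝ)
    (c : ℝ) : c • 1 ≤ conjDiag U d ↔ ∀ i, c ≤ d i := by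
  rw [← conjDiag_const hU, conjDiag_le_iff hU]

theorem aeval_conjDiag {U : Matrix N N ℂ} (hU : U ∈ unitaryGroup N ℂ) (d : N → ℝ)
    (q : Polynomial ℝ) :
    Polynomial.aeval (conjDiag U d) q = conjDiag U (fun i => q.eval (d i)) := by
  induction q using Polynomial.induction_on' with
  | add p q hp hq =>
    rw [map_add, hp, hq]
    simp [conjDiag, ← Matrix.add_mul, ← Matrix.mul_add]
  | monomial k a =>
    have hpow : conjDiag U d ^ k = conjDiag U (fun i => d i ^ k) := by
      induction k with
      | zero => simpa using (conjDiag_const hU 1).symm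
      | succ k ih => rw [pow_succ, ih, conjDiag_mul hU]; simp [pow_succ]
    rw [Polynomial.aeval_monomial, hpow, ← Algebra.smul_def]
    have : diagonal (fun i => ((a * d i ^ k : ℝ) : ℂ))
        = a • diagonal (fun i => ((d i ^ k : ℝ) : ℂ)) := by
      ext i j; by_cases hij : i = j <;> simp [hij]
    simp only [conjDiag, Polynomial.eval_monomial, this, Matrix.mul_smul, Matrix.smul_mul]

theorem conjDiag_rpow {U : Matrix N N ℂ} (hU : U ∈ unitaryGroup N ℂ) {d : N → ℝ}
    (hd : ∀ i, 0 < d i) (t : ℝ) : conjDiag U d ^ t = conjDiag U (fun i => d i ^ t) := by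
  have hpos := ((posSemidef_conjDiag_iff hU d).2 fun i => (hd i).le)
  have hsp : (spectrum ℝ (conjDiag U d)).Finite := finite_real_spectrum
  classical
  -- On a finite set the power function is a polynomial, which turns the functional calculus into
  -- algebra. Taking both the spectrum and the values of `d` as nodes avoids proving that they
  -- coincide.
  let s : Finset ℝ := hsp.toFinset ∪ Finset.univ.image d
  let q : Polynomial ℝ := Lagrange.interpolate s id (fun x => x ^ t)
  have hq : ∀ x ∈ s, q.eval x = x ^ t := fun x hx =>
    Lagrange.eval_interpolate_at_node (v := id) _ (Function.injective_id.injOn) hx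
  have h1 : conjDiag U d ^ t = cfc (fun x : ℝ => x ^ t) (conjDiag U d) :=
    CFC.rpow_eq_cfc_real hpos.nonneg
  have h2 : cfc (fun x : ℝ => x ^ t) (conjDiag U d) = cfc q.eval (conjDiag U d) := by
    refine cfc_congr fun x hx => (hq x ?_).symm
    simp [s, hx]
  rw [h1, h2]
  refine (cfc_polynomial q (conjDiag U d) hpos.isHermitian).trans ?_
  rw [aeval_conjDiag hU]
  congr 1
  funext i
  exact hq _ (by simp [s])

theorem posDef_rpow {A : Matrix N N ℂ} (hA : A.PosDef) (t : ℝ) : (A ^ t).PosDef := by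
  obtain ⟨U, hU, d, hd, rfl⟩ := exists_eq_conjDiag_pos hA
  rw [conjDiag_rpow hU hd, posDef_conjDiag_iff hU]
  exact fun i => Real.rpow_pos_of_pos (hd i) t

theorem star_rpow (A : Matrix N N ℂ) (t : ℝ) : star (A ^ t) = A ^ t :=
  (CFC.rpow_nonneg (a := A) (y := t)).isSelfAdjoint

theorem rpow_mul_rpow {A : Matrix N N ℂ} (hA : A.PosDef) (s t : ℝ) :
    A ^ s * A ^ t = A ^ (s + t) :=
  (CFC.rpow_add hA.isUnit).symm

theorem rpow_rpow {A : Matrix N N ℂ} (hA : A.PosDef) (s t : ℝ) :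
    (A ^ s) ^ t = A ^ (s * t) := by
  by_cases hs : s = 0
  · simp [hs, CFC.rpow_zero A hA.posSemidef.nonneg]
  · exact CFC.rpow_rpow A s t hs (isStrictlyPositive_iff_posDef.2 hA)

theorem rpow_zero {A : Matrix N N ℂ} (hA : A.PosDef) : A ^ (0 : ℝ) = 1 :=
  CFC.rpow_zero A hA.posSemidef.nonneg

theorem rpow_one {A : Matrix N N ℂ} (hA : A.PosDef) : A ^ (1 : ℝ) = A :=
  CFC.rpow_one A hA.posSemidef.nonneg

theorem smul_conjDiag (U : Matrix N N ℂ) (d : N → ℝ) (c : ℝ) :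
    c • conjDiag U d = conjDiag U (fun i => c * d i) := by
  have : diagonal (fun i => ((c * d i : ℝ) : ℂ)) = c • diagonal (fun i => (d i : ℂ)) := by
    ext i j; by_cases hij : i = j <;> simp [hij]
  simp only [conjDiag, this, Matrix.mul_smul, Matrix.smul_mul]

theorem smul_rpow {A : Matrix N N ℂ} (hA : A.PosDef) {c : ℝ} (hc : 0 < c) (t : ℝ) :
    (c • A) ^ t = c ^ t • A ^ t := by
  obtain ⟨U, hU, d, hd, rfl⟩ := exists_eq_conjDiag_pos hA
  rw [smul_conjDiag, conjDiag_rpow hU hd, conjDiag_rpow hU (fun i => mul_pos hc (hd i)),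
    smul_conjDiag]
  simp_rw [Real.mul_rpow hc.le (hd _).le]

theorem rpow_le_rpow {A B : Matrix N N ℂ} (h : A ≤ B) {t : ℝ} (h0 : 0 ≤ t) (h1 : t ≤ 1) :
    A ^ t ≤ B ^ t := by
  open scoped Matrix.Norms.L2Operator in
  exact CFC.rpow_le_rpow ⟨h0, h1⟩ h

/-- Inversion reverses the order; Löwner-Heinz then applies to the inverses. -/
theorem rpow_neg_le_rpow_neg {A B : Matrix N N ℂ} (hA : A.PosDef) (hB : B.PosDef) (h : A ≤ B)
    {t : ℝ} (h0 : 0 ≤ t) (h1 : t ≤ 1) : B ^ (-t) ≤ A ^ (-t) := by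
  have key : B ^ (-1 : ℝ) ≤ A ^ (-1 : ℝ) := by
    open scoped Matrix.Norms.L2Operator in
    exact CStarAlgebra.rpow_neg_one_le_rpow_neg_one h (isStrictlyPositive_iff_posDef.2 hA)
  have := rpow_le_rpow key h0 h1
  rwa [rpow_rpow hA, rpow_rpow hB, neg_one_mul] at this

theorem posDef_conj {A C : Matrix N N ℂ} (hC : C.PosDef) (hA : A.PosDef) :
    (C * A * C).PosDef := by
  have := hC.isUnit.posDef_star_right_conjugate_iff.2 hA
  rwa [show star C = C from hC.isHermitian] at this

/-- If `U` diagonalizes `star K * K` with eigenvalues `d`, then `V = K * U * diag(d ^ (-1/2))` is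
unitary and diagonalizes `K * star K` with the same eigenvalues. This transfers powers between the
two products and drives both Furuta's inequality and the symmetry of the mean. -/
theorem mul_star_rpow {K : Matrix N N ℂ} (hK : IsUnit K) (t : ℝ) :
    (K * star K) ^ t = K * (star K * K) ^ (t - 1) * star K := by
  have hp : (star K * K).PosDef := by
    simpa using hK.posDef_star_left_conjugate_iff.2 PosDef.one
  obtain ⟨U, hU, d, hd, h⟩ := exists_eq_conjDiag_pos hp
  have h1 := mem_unitaryGroup_iff.1 hU
  have h2 := mem_unitaryGroup_iff'.1 hU
  let V := K * U * diagonal (fun i => ((d i ^ (-(1 / 2) : ℝ) : ℝ) : ℂ))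
  have hVs : star V = diagonal (fun i => ((d i ^ (-(1 / 2) : ℝ) : ℝ) : ℂ)) * star U * star K := by
    simp only [V, star_mul, Matrix.mul_assoc]
    congr 1
    simp [star_eq_conjTranspose, diagonal_conjTranspose]
  have hdiag : star U * (star K * K) * U = diagonal (fun i => (d i : ℂ)) := by
    rw [h, conjDiag]
    calc _ = star U * U * diagonal (fun i => (d i : ℂ)) * (star U * U) := by
          simp only [Matrix.mul_assoc]
      _ = _ := by rw [h2]; simp
  have hV : V ∈ unitaryGroup N ℂ := by
    rw [mem_unitaryGroup_iff', hVs]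
    calc _ = diagonal (fun i => ((d i ^ (-(1 / 2) : ℝ) : ℝ) : ℂ)) * (star U * (star K * K) * U)
          * diagonal (fun i => ((d i ^ (-(1 / 2) : ℝ) : ℝ) : ℂ)) := by
          simp only [V, Matrix.mul_assoc]
      _ = 1 := by
          rw [hdiag, diagonal_mul_diagonal, diagonal_mul_diagonal, ← diagonal_one]
          congr 1
          funext i
          norm_cast
          have : d i = d i ^ (1 : ℝ) := (Real.rpow_one _).symm
          nth_rewrite 2 [this]
          rw [← Real.rpow_add (hd i), ← Real.rpow_add (hd i)]
          norm_num
  have hVe : ∀ e : N → ℝ, conjDiag V (fun i => e i)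
      = K * conjDiag U (fun i => e i * d i ^ (-1 : ℝ)) * star K := by
    intro e
    have hm : diagonal (fun i => ((d i ^ (-(1 / 2) : ℝ) : ℝ) : ℂ)) * diagonal (fun i => (e i : ℂ))
        * diagonal (fun i => ((d i ^ (-(1 / 2) : ℝ) : ℝ) : ℂ))
        = diagonal (fun i => ((e i * d i ^ (-1 : ℝ) : ℝ) : ℂ)) := by
      rw [diagonal_mul_diagonal, diagonal_mul_diagonal]
      congr 1
      funext i
      rw [← Complex.ofReal_mul, ← Complex.ofReal_mul, mul_comm _ (e i), mul_assoc,
        ← Real.rpow_add (hd i)]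
      norm_num
    rw [conjDiag, hVs, conjDiag, ← hm]
    simp only [V, Matrix.mul_assoc]
  have hKK : K * star K = conjDiag V d := by
    rw [hVe d]
    have : ∀ i, d i * d i ^ (-1 : ℝ) = 1 := fun i => by
      rw [Real.rpow_neg_one, mul_inv_cancel₀ (hd i).ne']
    simp_rw [this]
    rw [conjDiag_const hU]
    simp
  rw [hKK, conjDiag_rpow hV hd, hVe, h, conjDiag_rpow hU hd]
  congr 3
  funext i
  rw [← Real.rpow_add (hd i), sub_eq_add_neg]

end Powers

/-! ### Araki's inequality, Furuta's inequality and the norm bound for the geometric mean. -/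

section OperatorInequalities

variable {N : Type*} [Fintype N] [DecidableEq N]

theorem rpow_mul_rpow_mul_rpow {A : Matrix N N ℂ} (hA : A.PosDef) (r s t : ℝ) :
    A ^ r * A ^ s * A ^ t = A ^ (r + s + t) := by
  rw [rpow_mul_rpow hA, rpow_mul_rpow hA]

/-- Undoing a conjugation by a power. -/
theorem conj_neg_conj {A : Matrix N N ℂ} (hA : A.PosDef) (s : ℝ) (Z : Matrix N N ℂ) :
    A ^ (-s) * (A ^ s * Z * A ^ s) * A ^ (-s) = Z := by
  calc _ = (A ^ (-s) * A ^ s) * Z * (A ^ s * A ^ (-s)) := by simp only [Matrix.mul_assoc]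
    _ = Z := by simp [rpow_mul_rpow hA, rpow_zero hA]

theorem le_smul_rpow_of_conj_le {A B : Matrix N N ℂ} (hA : A.PosDef) {c : ℝ} {s : ℝ}
    (h : A ^ s * B * A ^ s ≤ c • 1) : B ≤ c • A ^ (-(2 * s)) := by
  have := conj_le_conj (star_rpow A (-s)) h
  rw [conj_neg_conj hA, Matrix.mul_smul, Matrix.smul_mul, Matrix.mul_one, rpow_mul_rpow hA] at this
  convert this using 3
  ring

/-- The operator norm form of the Araki-Lieb-Thirring inequality. -/
theorem araki {A B : Matrix N N ℂ} (hA : A.PosDef) {c : ℝ} (hc : 0 < c)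
    {s t : ℝ} (h0 : 0 ≤ t) (h1 : t ≤ 1) (h : A ^ s * B * A ^ s ≤ c • 1) :
    A ^ (s * t) * B ^ t * A ^ (s * t) ≤ c ^ t • 1 := by
  have h2 := rpow_le_rpow (le_smul_rpow_of_conj_le hA h) h0 h1
  rw [smul_rpow (posDef_rpow hA _) hc, rpow_rpow hA] at h2
  have h3 := conj_le_conj (star_rpow A (s * t)) h2
  rwa [Matrix.mul_smul, Matrix.smul_mul, rpow_mul_rpow_mul_rpow hA,
    show s * t + -(2 * s) * t + s * t = 0 by ring, rpow_zero hA] at h3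

/-- Furuta's inequality for `0 ≤ r ≤ 1`. -/
theorem furuta_of_le_one {P Q : Matrix N N ℂ} (hP : P.PosDef) (hQ : Q.PosDef) (h : Q ≤ P)
    {p r : ℝ} (hp : 1 ≤ p) (hr0 : 0 ≤ r) (hr1 : r ≤ 1) :
    (P ^ (r / 2) * Q ^ p * P ^ (r / 2)) ^ ((1 + r) / (p + r)) ≤ P ^ (1 + r) := by
  have hpr : 0 < p + r := by linarith
  set K := P ^ (r / 2) * Q ^ (p / 2) with hK
  have hKs : star K = Q ^ (p / 2) * P ^ (r / 2) := by rw [hK, star_mul, star_rpow, star_rpow]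
  have hKu : IsUnit K := (posDef_rpow hP _).isUnit.mul (posDef_rpow hQ _).isUnit
  have e1 : P ^ (r / 2) * Q ^ p * P ^ (r / 2) = K * star K := by
    rw [hKs, hK, show p = p / 2 + p / 2 by ring, ← rpow_mul_rpow hQ]
    simp only [Matrix.mul_assoc, add_self_div_two]
  have e2 : star K * K = Q ^ (p / 2) * P ^ r * Q ^ (p / 2) := by
    rw [hKs, hK, show r = r / 2 + r / 2 by ring, ← rpow_mul_rpow hP]
    simp only [Matrix.mul_assoc, add_self_div_two]
  -- Löwner-Heinz for the power `r` is where `r ≤ 1` enters.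
  have hle : Q ^ (p + r) ≤ star K * K := by
    have := conj_le_conj (star_rpow Q (p / 2)) (rpow_le_rpow h hr0 hr1)
    rw [rpow_mul_rpow_mul_rpow hQ] at this
    rw [e2]
    convert this using 2
    ring
  have hZ : (star K * K).PosDef := by
    rw [e2]; exact posDef_conj (posDef_rpow hQ _) (posDef_rpow hP _)
  -- The exponent left over by `mul_star_rpow` lies in `[-1, 0]`, so that power reverses the order
  -- and bounds the middle factor by `Q ^ (1 - p)`.
  have hα : (1 + r) / (p + r) - 1 = -((p - 1) / (p + r)) := by field_simp; ring
  have hZ2 : (star K * K) ^ ((1 + r) / (p + r) - 1) ≤ Q ^ (1 - p) := by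
    have := rpow_neg_le_rpow_neg (posDef_rpow hQ (p + r)) hZ hle
      (t := (p - 1) / (p + r)) (div_nonneg (by linarith) hpr.le)
      ((div_le_one hpr).2 (by linarith))
    rw [hα]
    refine this.trans_eq ?_
    rw [rpow_rpow hQ]
    congr 1
    field_simp
    ring
  rw [e1, mul_star_rpow hKu]
  calc K * (star K * K) ^ ((1 + r) / (p + r) - 1) * star K
      ≤ K * Q ^ (1 - p) * star K := star_right_conjugate_le_conjugate hZ2 K
    _ = P ^ (r / 2) * Q * P ^ (r / 2) := by
        rw [hKs, hK]
        calc _ = P ^ (r / 2) * (Q ^ (p / 2) * Q ^ (1 - p) * Q ^ (p / 2)) * P ^ (r / 2) := by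
              simp only [Matrix.mul_assoc]
          _ = _ := by
              rw [rpow_mul_rpow_mul_rpow hQ, show p / 2 + (1 - p) + p / 2 = 1 by ring, rpow_one hQ]
    _ ≤ P ^ (r / 2) * P * P ^ (r / 2) := conj_le_conj (star_rpow _ _) h
    _ = P ^ (1 + r) := by
        nth_rewrite 2 [← rpow_one hP]
        rw [rpow_mul_rpow_mul_rpow hP]
        congr 1
        ring

/-- Furuta's inequality for `1 ≤ r ≤ 3`. -/
theorem furuta {P Q : Matrix N N ℂ} (hP : P.PosDef) (hQ : Q.PosDef) (h : Q ≤ P)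
    {p r : ℝ} (hp : 1 ≤ p) (hr1 : 1 ≤ r) (hr3 : r ≤ 3) :
    (P ^ (r / 2) * Q ^ p * P ^ (r / 2)) ^ ((1 + r) / (p + r)) ≤ P ^ (1 + r) := by
  have h1 := furuta_of_le_one hP hQ h hp zero_le_one le_rfl
  have hT : (P ^ (1 / 2 : ℝ) * Q ^ p * P ^ (1 / 2 : ℝ)).PosDef :=
    posDef_conj (posDef_rpow hP _) (posDef_rpow hQ _)
  -- Bootstrapping: the case `r = 1` is an inequality below `P ^ 2`, to which the restricted form
  -- applies again. The new parameter `(r - 1) / 2` lies in `[0, 1]` exactly when `1 ≤ r ≤ 3`.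
  have h2 := furuta_of_le_one (posDef_rpow hP (1 + 1)) (posDef_rpow hT _) h1
    (p := (p + 1) / 2) (r := (r - 1) / 2) (by linarith) (by linarith) (by linarith)
  rw [rpow_rpow hP, rpow_rpow hP, rpow_rpow hT] at h2
  have e1 : (1 + 1 : ℝ) / (p + 1) * ((p + 1) / 2) = 1 := by field_simp; norm_num
  have e2 : (1 + (r - 1) / 2) / ((p + 1) / 2 + (r - 1) / 2) = (1 + r) / (p + r) := by
    have : 0 < p + r := by linarith
    have : (p + 1) / 2 + (r - 1) / 2 = (p + r) / 2 := by ring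
    rw [this]
    field_simp
    ring
  rw [e1, rpow_one hT, e2] at h2
  convert h2 using 2
  · have e3 : ∀ Z, P ^ ((1 + 1) * ((r - 1) / 2 / 2)) * (P ^ (1 / 2 : ℝ) * Z * P ^ (1 / 2 : ℝ))
        * P ^ ((1 + 1) * ((r - 1) / 2 / 2)) = P ^ (r / 2) * Z * P ^ (r / 2) := fun Z => by
      calc _ = (P ^ ((1 + 1) * ((r - 1) / 2 / 2)) * P ^ (1 / 2 : ℝ)) * Z
            * (P ^ (1 / 2 : ℝ) * P ^ ((1 + 1) * ((r - 1) / 2 / 2))) := by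
            simp only [Matrix.mul_assoc]
        _ = _ := by
          rw [rpow_mul_rpow hP, rpow_mul_rpow hP]
          ring_nf
    exact (e3 _).symm
  · ring

/-- The weighted geometric mean over an arbitrary index type. -/
noncomputable def geomMean (t : ℝ) (A B : Matrix N N ℂ) : Matrix N N ℂ :=
  A ^ (1 / 2 : ℝ) * (A ^ (-(1 / 2) : ℝ) * B * A ^ (-(1 / 2) : ℝ)) ^ t * A ^ (1 / 2 : ℝ)

theorem posDef_geomMean {A B : Matrix N N ℂ} (hA : A.PosDef) (hB : B.PosDef) (t : ℝ) :
    (geomMean t A B).PosDef :=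
  posDef_conj (posDef_rpow hA _) (posDef_rpow (posDef_conj (posDef_rpow hA _) hB) _)

/-- With `K = A ^ (-1/2) * B ^ (1/2)`, the middle factor is `K * star K`, while `star K * K` is the
inverse of the middle factor for the swapped pair. -/
theorem geomMean_comm {A B : Matrix N N ℂ} (hA : A.PosDef) (hB : B.PosDef) (t : ℝ) :
    geomMean t A B = geomMean (1 - t) B A := by
  set K := A ^ (-(1 / 2) : ℝ) * B ^ (1 / 2 : ℝ) with hK
  have hKs : star K = B ^ (1 / 2 : ℝ) * A ^ (-(1 / 2) : ℝ) := by
    rw [hK, star_mul, star_rpow, star_rpow]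
  have hKu : IsUnit K := (posDef_rpow hA _).isUnit.mul (posDef_rpow hB _).isUnit
  have hhalf : ∀ {C : Matrix N N ℂ}, C.PosDef → C ^ (1 / 2 : ℝ) * C ^ (1 / 2 : ℝ) = C := by
    intro C hC
    rw [rpow_mul_rpow hC, add_halves, rpow_one hC]
  have e1 : A ^ (-(1 / 2) : ℝ) * B * A ^ (-(1 / 2) : ℝ) = K * star K := by
    nth_rewrite 1 [← hhalf hB]
    rw [hKs, hK]
    simp only [Matrix.mul_assoc]
  set Y := B ^ (-(1 / 2) : ℝ) * A * B ^ (-(1 / 2) : ℝ) with hY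
  have hYp : Y.PosDef := posDef_conj (posDef_rpow hB _) hA
  have e2 : star K * K * Y = 1 := by
    rw [hKs, hK, hY]
    calc _ = B ^ (1 / 2 : ℝ) * (A ^ (-(1 / 2) : ℝ) * A ^ (-(1 / 2) : ℝ)) *
          (B ^ (1 / 2 : ℝ) * B ^ (-(1 / 2) : ℝ)) * A * B ^ (-(1 / 2) : ℝ) := by
          simp only [Matrix.mul_assoc]
      _ = B ^ (1 / 2 : ℝ) * (A ^ (-(1 / 2) + -(1 / 2) : ℝ) * A ^ (1 : ℝ)) * B ^ (-(1 / 2) : ℝ) := by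
          rw [rpow_mul_rpow hA, rpow_mul_rpow hB, rpow_one hA]
          norm_num [rpow_zero hB, Matrix.mul_assoc]
      _ = 1 := by
          rw [rpow_mul_rpow hA]
          norm_num [rpow_zero hA, rpow_mul_rpow hB, rpow_zero hB]
  have e3 : star K * K = Y ^ (-1 : ℝ) := by
    have h1 : Y * Y ^ (-1 : ℝ) = 1 := by
      nth_rewrite 1 [← rpow_one hYp]
      rw [rpow_mul_rpow hYp]
      norm_num [rpow_zero hYp]
    calc star K * K = star K * K * (Y * Y ^ (-1 : ℝ)) := by rw [h1, Matrix.mul_one]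
      _ = _ := by rw [← Matrix.mul_assoc, e2, Matrix.one_mul]
  have e4 : A ^ (1 / 2 : ℝ) * K = B ^ (1 / 2 : ℝ) := by
    rw [hK, ← Matrix.mul_assoc, rpow_mul_rpow hA]
    norm_num [rpow_zero hA]
  have e5 : star K * A ^ (1 / 2 : ℝ) = B ^ (1 / 2 : ℝ) := by
    rw [hKs, Matrix.mul_assoc, rpow_mul_rpow hA]
    norm_num [rpow_zero hA]
  rw [geomMean, geomMean, e1, mul_star_rpow hKu, e3, rpow_rpow hYp]
  calc _ = (A ^ (1 / 2 : ℝ) * K) * Y ^ (-1 * (t - 1)) * (star K * A ^ (1 / 2 : ℝ)) := by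
        simp only [Matrix.mul_assoc]
    _ = _ := by rw [e4, e5, show -1 * (t - 1) = 1 - t by ring]

theorem geomMean_le_of_le_half {A B : Matrix N N ℂ} (hA : A.PosDef) (hB : B.PosDef) {c : ℝ}
    (hc : 0 < c) {t : ℝ} (h0 : 0 ≤ t) (h1 : t ≤ 1 / 2)
    (h : A ^ ((1 - t) / 2) * B ^ t * A ^ ((1 - t) / 2) ≤ c • 1) : geomMean t A B ≤ c • 1 := by
  -- The endpoint is separate because Furuta's inequality is used below with `p = 1 / t`.
  obtain rfl | h0 := h0.eq_or_lt
  · rw [rpow_zero hB, Matrix.mul_one, rpow_mul_rpow hA] at h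
    rw [geomMean, rpow_zero (posDef_conj (posDef_rpow hA _) hB), Matrix.mul_one, rpow_mul_rpow hA]
    convert h using 2
    norm_num
  have ht : 0 < 1 - t := by linarith
  have hle := le_smul_rpow_of_conj_le hA h
  rw [show -(2 * ((1 - t) / 2)) = -(1 - t) by ring] at hle
  set P := c • A ^ (-(1 - t)) with hP
  have hPp : P.PosDef := (posDef_rpow hA _).smul hc
  have hPpow : ∀ x : ℝ, P ^ x = c ^ x • A ^ (-(1 - t) * x) := fun x => by
    rw [hP, smul_rpow (posDef_rpow hA _) hc, rpow_rpow hA]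
  set r := 1 / (1 - t) with hr
  have hr1 : 1 ≤ r := by rw [hr, le_div_iff₀ ht]; linarith
  have hr2 : r ≤ 2 := by rw [hr, div_le_iff₀ ht]; linarith
  -- The hypothesis reads `B ^ t ≤ P`. The choice `p = 1 / t` recovers `B`, and `r = 1 / (1 - t)`
  -- turns `P ^ (r / 2)` into a multiple of `A ^ (-1/2)`, so the sandwich is a multiple of `W`.
  have hF := furuta hPp (posDef_rpow hB t) hle (p := 1 / t) (r := r)
    ((le_div_iff₀ h0).2 (by linarith)) hr1 (by linarith)
  set W := A ^ (-(1 / 2) : ℝ) * B * A ^ (-(1 / 2) : ℝ) with hW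
  have hWp : W.PosDef := posDef_conj (posDef_rpow hA _) hB
  have e1 : P ^ (r / 2) * (B ^ t) ^ (1 / t) * P ^ (r / 2) = c ^ r • W := by
    rw [rpow_rpow hB, mul_one_div_cancel h0.ne', rpow_one hB, hPpow,
      show -(1 - t) * (r / 2) = -(1 / 2) by rw [hr]; field_simp]
    simp only [Matrix.smul_mul, Matrix.mul_smul, smul_smul, ← Real.rpow_add hc, add_halves, hW]
  rw [e1] at hF
  -- The outer exponents are now `t * (2 - t)` and `(2 - t) / (1 - t)`; the power `1 / (2 - t)`
  -- brings them to `t` and `r`.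
  have hg := rpow_le_rpow hF (t := 1 / (2 - t)) (by apply div_nonneg <;> linarith)
    ((div_le_one (by linarith)).2 (by linarith))
  have hcr : 0 < c ^ r := Real.rpow_pos_of_pos hc _
  rw [rpow_rpow (hWp.smul hcr), rpow_rpow hPp] at hg
  have h2t : 2 - t ≠ 0 := by linarith
  have x1 : (1 + r) / (1 / t + r) * (1 / (2 - t)) = t := by
    have : 1 / t + r = 1 / (t * (1 - t)) := by rw [hr]; field_simp; ring
    rw [this, hr]; field_simp; ring
  have x2 : (1 + r) * (1 / (2 - t)) = r := by rw [hr]; field_simp; ring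
  rw [x1, x2, smul_rpow hWp hcr, hPpow, show -(1 - t) * r = -1 by rw [hr]; field_simp] at hg
  have hfin := conj_le_conj (star_rpow A (1 / 2 : ℝ)) hg
  simp only [Matrix.mul_smul, Matrix.smul_mul] at hfin
  rw [rpow_mul_rpow_mul_rpow hA, show (1 / 2 + -1 + 1 / 2 : ℝ) = 0 by norm_num, rpow_zero hA,
    ← Real.rpow_mul hc.le] at hfin
  have hfin2 := smul_le_smul_of_nonneg_left hfin (Real.rpow_pos_of_pos hc (-(r * t))).le
  rw [smul_smul, smul_smul, ← Real.rpow_add hc, ← Real.rpow_add hc, neg_add_cancel,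
    Real.rpow_zero, one_smul, show -(r * t) + r = 1 by rw [hr]; field_simp; ring,
    Real.rpow_one] at hfin2
  exact hfin2

end OperatorInequalities

/-! ### Compound matrices and their compatibility with products, adjoints and powers. -/

section Compound

variable {n k : ℕ}

/-- The index type of the `k`-th compound of an `n × n` matrix. -/
abbrev CompoundIndex (n k : ℕ) : Type := {s : Finset (Fin n) // s.card = k}

/-- The increasing enumeration of a `k`-element subset of `Fin n`. -/
def CompoundIndex.enum (s : CompoundIndex n k) : Fin k ↪o Fin n := s.1.orderEmbOfFin s.2

/-- The `k`-th compound matrix, whose entries are the `k × k` minors. -/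
def compound (k : ℕ) (A : Matrix (Fin n) (Fin n) ℂ) :
    Matrix (CompoundIndex n k) (CompoundIndex n k) ℂ :=
  of fun s t => (A.submatrix s.enum t.enum).det

/-- With `exists_enum_comp`, this factors injective maps `Fin k → Fin n` uniquely as a permutation
followed by an increasing enumeration, the reindexing behind Cauchy-Binet. -/
theorem CompoundIndex.enum_comp_injective :
    Function.Injective (fun p : CompoundIndex n k × Equiv.Perm (Fin k) => p.1.enum ∘ p.2) := by
  rintro ⟨s, σ⟩ ⟨t, τ⟩ h
  have hst : s = t := by
    have h' := congrArg Set.range h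
    simp only [EquivLike.range_comp] at h'
    rw [enum, enum, Finset.range_orderEmbOfFin, Finset.range_orderEmbOfFin] at h'
    exact Subtype.ext (Finset.coe_injective h')
  subst hst
  congr 1
  ext i
  have := congrFun h i
  simp only [Function.comp_apply, EmbeddingLike.apply_eq_iff_eq] at this
  rw [this]

theorem CompoundIndex.exists_enum_comp {φ : Fin k → Fin n} (hφ : Function.Injective φ) :
    ∃ p : CompoundIndex n k × Equiv.Perm (Fin k), p.1.enum ∘ p.2 = φ := by
  let s : CompoundIndex n k := ⟨Finset.univ.image φ, by
    rw [Finset.card_image_of_injective _ hφ, Finset.card_fin]⟩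
  have hmem : ∀ i, φ i ∈ s.1 := fun i => Finset.mem_image_of_mem _ (Finset.mem_univ i)
  let f : Fin k → Fin k := fun i => (s.1.orderIsoOfFin s.2).symm ⟨φ i, hmem i⟩
  have hf : Function.Injective f := fun i j h => by
    have := (s.1.orderIsoOfFin s.2).symm.injective h
    exact hφ (congrArg Subtype.val this)
  refine ⟨(s, Equiv.ofBijective f (Finite.injective_iff_bijective.1 hf)), ?_⟩
  funext i
  simp only [Function.comp_apply, Equiv.ofBijective_apply, enum]
  rw [← Finset.coe_orderIsoOfFin_apply]
  simp [f]

/-- The Cauchy-Binet formula. -/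
theorem compound_mul (A B : Matrix (Fin n) (Fin n) ℂ) :
    compound k (A * B) = compound k A * compound k B := by
  ext s t
  have hrow : (A * B).submatrix s.enum t.enum
      = fun i => ∑ l, A (s.enum i) l • fun j => B l (t.enum j) := by
    ext i j
    simp [Matrix.mul_apply]
  -- Multilinearity in the rows gives a sum over all maps `φ`; non-injective ones repeat a row and
  -- vanish, the others group into minors.
  have hexp : compound k (A * B) s t
      = ∑ φ : Fin k → Fin n, (∏ i, A (s.enum i) (φ i)) * (B.submatrix φ t.enum).det := by
    change ((A * B).submatrix s.enum t.enum).det = _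
    rw [hrow]
    change (detRowAlternating : (Fin k → ℂ) [⋀^Fin k]→ₗ[ℂ] ℂ).toMultilinearMap _ = _
    rw [MultilinearMap.map_sum]
    refine Finset.sum_congr rfl fun φ _ => ?_
    rw [MultilinearMap.map_smul_univ]
    rfl
  rw [hexp, Matrix.mul_apply]
  rw [← Fintype.sum_of_injective _ CompoundIndex.enum_comp_injective
    (fun p => (∏ i, A (s.enum i) (p.1.enum (p.2 i)))
      * (B.submatrix (p.1.enum ∘ p.2) t.enum).det) _ ?_ (fun _ => rfl)]
  · rw [Fintype.sum_prod_type]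
    refine Finset.sum_congr rfl fun u _ => ?_
    have h1 : ∀ σ : Equiv.Perm (Fin k), (B.submatrix (u.enum ∘ σ) t.enum).det
        = Equiv.Perm.sign σ * (B.submatrix u.enum t.enum).det := fun σ => by
      rw [← det_permute]; rfl
    simp only [h1, compound, of_apply]
    rw [← det_transpose (A.submatrix s.enum u.enum), det_apply' (A.submatrix s.enum u.enum)ᵀ,
      Finset.sum_mul]
    refine Finset.sum_congr rfl fun σ _ => ?_
    simp only [transpose_apply, submatrix_apply]
    ring
  · intro φ hφ
    have hni : ¬ Function.Injective φ := fun h => hφ (CompoundIndex.exists_enum_comp h)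
    rw [Function.not_injective_iff] at hni
    obtain ⟨i, j, hij, hne⟩ := hni
    rw [det_zero_of_row_eq hne (by ext; simp [hij]), mul_zero]

theorem compound_diagonal (d : Fin n → ℂ) :
    compound k (diagonal d) = diagonal (fun s : CompoundIndex n k => ∏ i ∈ s.1, d i) := by
  ext s t
  by_cases hst : s = t
  · subst hst
    have : (diagonal d).submatrix s.enum s.enum = diagonal (d ∘ s.enum) :=
      submatrix_diagonal _ _ s.enum.injective
    simp only [compound, of_apply, this, det_diagonal, diagonal_apply_eq, Function.comp_apply]
    refine (Finset.prod_map Finset.univ s.enum.toEmbedding d).symm.trans ?_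
    rw [CompoundIndex.enum, Finset.map_orderEmbOfFin_univ]
  · rw [diagonal_apply_ne _ hst]
    have hns : ¬ s.1 ⊆ t.1 := fun h =>
      hst (Subtype.ext (Finset.eq_of_subset_of_card_le h (by rw [s.2, t.2])))
    obtain ⟨x, hxs, hxt⟩ := Finset.not_subset.1 hns
    obtain ⟨i, rfl⟩ : x ∈ Set.range s.enum := by
      rw [CompoundIndex.enum, Finset.range_orderEmbOfFin]; exact hxs
    refine det_eq_zero_of_row_eq_zero i fun j => diagonal_apply_ne _ fun h => hxt ?_
    rw [h]
    exact Finset.orderEmbOfFin_mem _ _ _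

theorem compound_one : compound k (1 : Matrix (Fin n) (Fin n) ℂ) = 1 := by
  rw [← diagonal_one, compound_diagonal]
  simp

theorem compound_star (A : Matrix (Fin n) (Fin n) ℂ) : 
    compound k (star A) = star (compound k A) := by
  ext s t
  change ((star A).submatrix s.enum t.enum).det = star ((A.submatrix t.enum s.enum).det)
  rw [← det_conjTranspose]
  rfl

theorem compound_mem_unitaryGroup {U : Matrix (Fin n) (Fin n) ℂ} (hU : U ∈ unitaryGroup (Fin n) ℂ) :
    compound k U ∈ unitaryGroup (CompoundIndex n k) ℂ := by
  rw [mem_unitaryGroup_iff, ← compound_star, ← compound_mul, mem_unitaryGroup_iff.1 hU,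
    compound_one]

theorem compound_conjDiag (U : Matrix (Fin n) (Fin n) ℂ) (d : Fin n → ℝ) :
    compound k (conjDiag U d) = conjDiag (compound k U) (fun s => ∏ i ∈ s.1, d i) := by
  rw [conjDiag, conjDiag, compound_mul, compound_mul, compound_star, compound_diagonal]
  push_cast
  rfl

theorem posDef_compound {A : Matrix (Fin n) (Fin n) ℂ} (hA : A.PosDef) :
    (compound k A).PosDef := by
  obtain ⟨U, hU, d, hd, rfl⟩ := exists_eq_conjDiag_pos hA
  rw [compound_conjDiag, posDef_conjDiag_iff (compound_mem_unitaryGroup hU)]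
  exact fun s => Finset.prod_pos fun i _ => hd i

theorem compound_rpow {A : Matrix (Fin n) (Fin n) ℂ} (hA : A.PosDef) (t : ℝ) :
    compound k (A ^ t) = compound k A ^ t := by
  obtain ⟨U, hU, d, hd, rfl⟩ := exists_eq_conjDiag_pos hA
  rw [conjDiag_rpow hU hd, compound_conjDiag, compound_conjDiag,
    conjDiag_rpow (compound_mem_unitaryGroup hU) fun s => Finset.prod_pos fun i _ => hd i]
  congr 1
  funext s
  exact (Real.finsetProd_rpow _ _ (fun i _ => (hd i).le) t)

end Compound

/-! ### Decreasing rearrangements and products of largest components. -/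

section Rearrangement

variable {n : ℕ}

theorem decr_map (x : Fin n → ℝ) : Finset.univ.val.map (decr x) = Finset.univ.val.map x := by
  obtain ⟨σ, h⟩ := decr_perm x
  rw [h, ← Multiset.map_map]
  congr 1
  exact congrArg Finset.val (Finset.map_univ_equiv σ)

theorem decr_eq_of_antitone {x y : Fin n → ℝ} (hy : Antitone y)
    (h : Finset.univ.val.map x = Finset.univ.val.map y) : decr x = y := by
  apply List.ofFn_injective
  refine List.Perm.eq_of_sortedGE (decr_antitone x).sortedGE_ofFn hy.sortedGE_ofFn ?_
  rw [← Multiset.coe_eq_coe, ← Fin.univ_val_map, ← Fin.univ_val_map, decr_map, h]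

theorem decr_congr {x y : Fin n → ℝ} (h : Finset.univ.val.map x = Finset.univ.val.map y) :
    decr x = decr y :=
  decr_eq_of_antitone (decr_antitone y) (h.trans (decr_map y).symm)

theorem decr_nonneg {x : Fin n → ℝ} : (∀ i, 0 ≤ decr x i) ↔ ∀ i, 0 ≤ x i := by
  obtain ⟨σ, h⟩ := decr_perm x
  rw [h]
  exact ⟨fun hx i => by simpa using hx (σ.symm i), fun hx i => hx _⟩

theorem decr_rpow {x : Fin n → ℝ} (hx : ∀ i, 0 ≤ x i) {t : ℝ} (ht : 0 ≤ t) :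
    decr (fun i => x i ^ t) = fun i => decr x i ^ t := by
  refine decr_eq_of_antitone (fun i j hij => ?_) ?_
  · exact Real.rpow_le_rpow (decr_nonneg.2 hx j) (decr_antitone x hij) ht
  · have := congrArg (Multiset.map (fun a : ℝ => a ^ t)) (decr_map x)
    rw [Multiset.map_map, Multiset.map_map] at this
    exact this.symm

theorem topProd_congr {x y : Fin n → ℝ} (h : decr x = decr y) (k : ℕ) :
    topProd x k = topProd y k := by
  rw [topProd, topProd, h]

theorem topProd_nonneg {x : Fin n → ℝ} (hx : ∀ i, 0 ≤ x i) (k : ℕ) : 0 ≤ topProd x k :=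
  Finset.prod_nonneg fun i _ => decr_nonneg.2 hx i

theorem topProd_pos {x : Fin n → ℝ} (hx : ∀ i, 0 < x i) (k : ℕ) : 0 < topProd x k := by
  obtain ⟨σ, h⟩ := decr_perm x
  rw [topProd, h]
  exact Finset.prod_pos fun i _ => hx _

theorem topProd_rpow {x : Fin n → ℝ} (hx : ∀ i, 0 ≤ x i) {t : ℝ} (ht : 0 ≤ t) (k : ℕ) :
    topProd (fun i => x i ^ t) k = topProd x k ^ t := by
  rw [topProd, decr_rpow hx ht]
  exact Real.finsetProd_rpow _ _ (fun i _ => decr_nonneg.2 hx i) t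

theorem topProd_self (x : Fin n → ℝ) : topProd x n = ∏ i, x i := by
  have : topProd x n = ∏ i, decr x i := by simp [topProd]
  rw [this, Finset.prod_eq_multiset_prod, decr_map, ← Finset.prod_eq_multiset_prod]

theorem val_le_orderEmb {k : ℕ} (e : Fin k ↪o Fin n) (i : Fin k) : i.val ≤ (e i).val := by
  obtain ⟨i, hi⟩ := i
  induction i with
  | zero => exact Nat.zero_le _
  | succ i ih =>
    have h1 := ih (Nat.lt_of_succ_lt hi)
    have h2 : e ⟨i, Nat.lt_of_succ_lt hi⟩ < e ⟨i + 1, hi⟩ := e.strictMono (by simp)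
    exact Nat.succ_le_of_lt (lt_of_le_of_lt h1 h2)

/-- The top product is the maximum over `k`-subsets, because the `i`-th smallest index in any subset
is at least `i`. These subset products are the eigenvalues of the compound. -/
theorem topProd_le_iff {x : Fin n → ℝ} (hx : ∀ i, 0 ≤ x i) {k : ℕ} (hk : k ≤ n) (c : ℝ) :
    topProd x k ≤ c ↔ ∀ s : CompoundIndex n k, ∏ i ∈ s.1, x i ≤ c := by
  obtain ⟨σ, hσ⟩ := decr_perm x
  have hfilter : (Finset.univ.filter fun i : Fin n => i.val < k)
      = Finset.univ.map (Fin.castLEEmb hk) := by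
    ext i
    simp only [Finset.mem_filter, Finset.mem_univ, true_and, Finset.mem_map]
    exact ⟨fun h => ⟨⟨i, h⟩, rfl⟩, by rintro ⟨j, rfl⟩; exact j.2⟩
  have htop : topProd x k = ∏ i : Fin k, decr x (Fin.castLE hk i) := by
    rw [topProd, hfilter, Finset.prod_map]
    rfl
  constructor
  · intro h s
    refine le_trans ?_ h
    let t : CompoundIndex n k := ⟨s.1.map σ.symm.toEmbedding, by rw [Finset.card_map, s.2]⟩
    calc ∏ i ∈ s.1, x i = ∏ i ∈ t.1, decr x i := by simp [t, hσ]
      _ = ∏ i : Fin k, decr x (t.enum i) := by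
          rw [← Finset.map_orderEmbOfFin_univ t.1 t.2, Finset.prod_map]; rfl
      _ ≤ ∏ i : Fin k, decr x (Fin.castLE hk i) :=
          Finset.prod_le_prod (fun i _ => decr_nonneg.2 hx _) fun i _ =>
            decr_antitone x (val_le_orderEmb t.enum i)
      _ = topProd x k := htop.symm
  · intro h
    have := h ⟨(Finset.univ.map (Fin.castLEEmb hk)).map σ.toEmbedding, by simp⟩
    rw [htop]
    simpa [Finset.prod_map, hσ] using this

theorem LogMaj.congr {x y x' y' : Fin n → ℝ} (h : LogMaj x y) (hx : decr x = decr x')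
    (hy : decr y = decr y') : LogMaj x' y' := by
  obtain ⟨⟨h1, h2, h3⟩, h4⟩ := h
  refine ⟨⟨?_, ?_, fun k hk hkn => ?_⟩, ?_⟩
  · rw [← decr_nonneg, ← hx]; exact decr_nonneg.2 h1
  · rw [← decr_nonneg, ← hy]; exact decr_nonneg.2 h2
  · rw [← topProd_congr hx, ← topProd_congr hy]; exact h3 k hk hkn
  · rw [← topProd_congr hx, ← topProd_congr hy]; exact h4

theorem LogMaj.rpow {x y : Fin n → ℝ} (h : LogMaj x y) {t : ℝ} (ht : 0 ≤ t) :
    LogMaj (fun i => x i ^ t) (fun i => y i ^ t) := by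
  obtain ⟨⟨h1, h2, h3⟩, h4⟩ := h
  refine ⟨⟨fun i => Real.rpow_nonneg (h1 i) t, fun i => Real.rpow_nonneg (h2 i) t,
    fun k hk hkn => ?_⟩, ?_⟩
  · rw [topProd_rpow h1 ht, topProd_rpow h2 ht]
    exact Real.rpow_le_rpow (topProd_nonneg h1 k) (h3 k hk hkn) ht
  · rw [topProd_rpow h1 ht, topProd_rpow h2 ht, h4]

end Rearrangement

/-! ### Eigenvalue tuples, determinants and singular values. -/

section Eigenvalues

variable {n : ℕ}

theorem eig_congr {X Y : Matrix (Fin n) (Fin n) ℂ} (h : X.charpoly = Y.charpoly) :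
    eig X = eig Y := by
  unfold eig
  congr! 1
  simp [h]

theorem lam_congr {X Y : Matrix (Fin n) (Fin n) ℂ} (h : X.charpoly = Y.charpoly) :
    lam X = lam Y := by
  unfold lam
  rw [eig_congr h]

theorem eig_map_conjDiag {U : Matrix (Fin n) (Fin n) ℂ} (hU : U ∈ unitaryGroup (Fin n) ℂ)
    (d : Fin n → ℝ) :
    Finset.univ.val.map (eig (conjDiag U d)) = Finset.univ.val.map (fun i => (d i : ℂ)) := by
  have h : (conjDiag U d).charpoly = (diagonal fun i => (d i : ℂ)).charpoly := by
    rw [conjDiag, charpoly_mul_comm, ← Matrix.mul_assoc, mem_unitaryGroup_iff'.1 hU,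
      Matrix.one_mul]
  rw [map_eig, h, charpoly_diagonal, Polynomial.roots_prod _ _
    (Finset.prod_ne_zero_iff.2 fun i _ => Polynomial.X_sub_C_ne_zero _)]
  simp

theorem lam_map_conjDiag {U : Matrix (Fin n) (Fin n) ℂ} (hU : U ∈ unitaryGroup (Fin n) ℂ)
    (d : Fin n → ℝ) :
    Finset.univ.val.map (lam (conjDiag U d)) = Finset.univ.val.map d := by
  have := congrArg (Multiset.map Complex.re) (eig_map_conjDiag hU d)
  rw [Multiset.map_map, Multiset.map_map] at this
  exact this

theorem hasPosEig_of_posDef {M : Matrix (Fin n) (Fin n) ℂ} (hM : M.PosDef) : HasPosEig M := by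
  obtain ⟨U, hU, d, hd, rfl⟩ := exists_eq_conjDiag_pos hM
  intro i
  have : eig (conjDiag U d) i ∈ Finset.univ.val.map (eig (conjDiag U d)) :=
    Multiset.mem_map_of_mem _ (Finset.mem_univ i)
  rw [eig_map_conjDiag hU] at this
  obtain ⟨j, -, hj⟩ := Multiset.mem_map.1 this
  rw [← hj]
  exact ⟨Complex.ofReal_im _, by simpa using hd j⟩

theorem HasPosEig.congr {X Y : Matrix (Fin n) (Fin n) ℂ} (hX : HasPosEig X)
    (h : X.charpoly = Y.charpoly) : HasPosEig Y := by
  unfold HasPosEig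
  rw [← eig_congr h]
  exact hX

theorem lam_pos {M : Matrix (Fin n) (Fin n) ℂ} (hM : M.PosDef) (i : Fin n) : 0 < lam M i :=
  (hasPosEig_of_posDef hM i).2

theorem lam_nonneg {M : Matrix (Fin n) (Fin n) ℂ} (hM : M.PosDef) (i : Fin n) : 0 ≤ lam M i :=
  (lam_pos hM i).le

/-- The bridge from log-majorization to the Loewner order. -/
theorem topProd_lam_le_iff {M : Matrix (Fin n) (Fin n) ℂ} (hM : M.PosDef) {k : ℕ} (hk : k ≤ n)
    (c : ℝ) : topProd (lam M) k ≤ c ↔ compound k M ≤ c • 1 := by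
  obtain ⟨U, hU, d, hd, rfl⟩ := exists_eq_conjDiag_pos hM
  rw [topProd_congr (decr_congr (lam_map_conjDiag hU d)), topProd_le_iff (fun i => (hd i).le) hk,
    compound_conjDiag, conjDiag_le_smul_one_iff (compound_mem_unitaryGroup hU)]

theorem det_conjDiag {U : Matrix (Fin n) (Fin n) ℂ} (hU : U ∈ unitaryGroup (Fin n) ℂ)
    (d : Fin n → ℝ) : (conjDiag U d).det = ((∏ i, d i : ℝ) : ℂ) := by
  rw [conjDiag, det_mul_comm, ← Matrix.mul_assoc, mem_unitaryGroup_iff'.1 hU]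
  simp

/-- The determinant of a positive definite matrix as a real number. -/
def rdet (M : Matrix (Fin n) (Fin n) ℂ) : ℝ := M.det.re

theorem rdet_conjDiag {U : Matrix (Fin n) (Fin n) ℂ} (hU : U ∈ unitaryGroup (Fin n) ℂ)
    (d : Fin n → ℝ) : rdet (conjDiag U d) = ∏ i, d i := by
  rw [rdet, det_conjDiag hU, Complex.ofReal_re]

theorem rdet_pos {M : Matrix (Fin n) (Fin n) ℂ} (hM : M.PosDef) : 0 < rdet M := by
  obtain ⟨U, hU, d, hd, rfl⟩ := exists_eq_conjDiag_pos hM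
  rw [rdet_conjDiag hU]
  exact Finset.prod_pos fun i _ => hd i

theorem rdet_mul {M M' : Matrix (Fin n) (Fin n) ℂ} (hM : M.PosDef) :
    rdet (M * M') = rdet M * rdet M' := by
  obtain ⟨U, hU, d, hd, rfl⟩ := exists_eq_conjDiag_pos hM
  rw [rdet_conjDiag hU, rdet, det_mul, det_conjDiag hU, Complex.re_ofReal_mul, rdet]

theorem rdet_conj {C M : Matrix (Fin n) (Fin n) ℂ} (hC : C.PosDef) (hM : M.PosDef) :
    rdet (C * M * C) = rdet C ^ 2 * rdet M := by
  rw [Matrix.mul_assoc, rdet_mul hC, rdet_mul hM]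
  ring

theorem rdet_rpow {M : Matrix (Fin n) (Fin n) ℂ} (hM : M.PosDef) (t : ℝ) :
    rdet (M ^ t) = rdet M ^ t := by
  obtain ⟨U, hU, d, hd, rfl⟩ := exists_eq_conjDiag_pos hM
  rw [conjDiag_rpow hU hd, rdet_conjDiag hU, rdet_conjDiag hU]
  exact Real.finsetProd_rpow _ _ (fun i _ => (hd i).le) t

theorem topProd_lam_self {M : Matrix (Fin n) (Fin n) ℂ} (hM : M.PosDef) :
    topProd (lam M) n = rdet M := by
  obtain ⟨U, hU, d, hd, rfl⟩ := exists_eq_conjDiag_pos hM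
  rw [topProd_congr (decr_congr (lam_map_conjDiag hU d)), topProd_self, rdet_conjDiag hU]

theorem decr_sing (X : Matrix (Fin n) (Fin n) ℂ) :
    decr (sing X) = decr (fun i => lam (star X * X) i ^ (1 / 2 : ℝ)) := by
  set T := toEuclideanLin X with hT
  have hTT : LinearMap.adjoint T ∘ₗ T = toEuclideanLin (star X * X) := by
    rw [hT, star_eq_conjTranspose, ← toEuclideanLin_conjTranspose_eq_adjoint]
    exact (toLpLin_mul_same 2 _ _).symm
  have hn : Module.finrank ℂ (EuclideanSpace ℂ (Fin n)) = n := by simp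
  have hch : (LinearMap.adjoint T ∘ₗ T).charpoly = (star X * X).charpoly := by
    have h : toEuclideanLin (star X * X)
        = toLin (PiLp.basisFun 2 ℂ (Fin n)) (PiLp.basisFun 2 ℂ (Fin n)) (star X * X) := rfl
    rw [hTT, h, charpoly_toLin]
  have hroots := T.isSymmetric_adjoint_comp_self.roots_charpoly_eq_eigenvalues hn
  rw [hch, ← map_eig] at hroots
  have hre := congrArg (Multiset.map Complex.re) hroots
  rw [Multiset.map_map, Multiset.map_map] at hre
  have hsing : sing X
      = fun i => T.isSymmetric_adjoint_comp_self.eigenvalues hn i ^ (1 / 2 : ℝ) := by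
    funext i
    rw [← Real.sqrt_eq_rpow]
    exact T.singularValues_fin hn i
  rw [hsing]
  refine decr_congr ?_
  have := congrArg (Multiset.map (fun a : ℝ => a ^ (1 / 2 : ℝ))) hre
  rw [Multiset.map_map, Multiset.map_map] at this
  exact this.symm

end Eigenvalues

/-! ### The log-majorization links of both chains. -/

section LogMajorization

variable {n : ℕ}

/-- The Araki-Lieb-Thirring log majorization. -/
theorem logMaj_araki {A B : Matrix (Fin n) (Fin n) ℂ} (hA : A.PosDef) (hB : B.PosDef)
    {s t : ℝ} (h0 : 0 ≤ t) (h1 : t ≤ 1) :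
    LogMaj (lam (A ^ (s * t) * B ^ t * A ^ (s * t)))
      (fun i => lam (A ^ s * B * A ^ s) i ^ t) := by
  have hM := posDef_conj (posDef_rpow hA (s * t)) (posDef_rpow hB t)
  have hM' := posDef_conj (posDef_rpow hA s) hB
  refine ⟨⟨lam_nonneg hM, fun i => Real.rpow_nonneg (lam_nonneg hM' i) t, fun k _ hk => ?_⟩, ?_⟩
  · rw [topProd_rpow (lam_nonneg hM') h0, topProd_lam_le_iff hM hk, compound_mul, compound_mul,
      compound_rpow hA, compound_rpow hB]
    refine araki (posDef_compound hA) (topProd_pos (lam_pos hM') k) h0 h1 ?_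
    rw [← compound_rpow hA, ← compound_mul, ← compound_mul, ← topProd_lam_le_iff hM' hk]
  · rw [topProd_rpow (lam_nonneg hM') h0, topProd_lam_self hM, topProd_lam_self hM',
      rdet_conj (posDef_rpow hA _) (posDef_rpow hB t), rdet_conj (posDef_rpow hA _) hB,
      rdet_rpow hA, rdet_rpow hA, rdet_rpow hB, Real.mul_rpow (by positivity) (rdet_pos hB).le,
      ← Real.rpow_natCast, ← Real.rpow_natCast, ← Real.rpow_mul (rdet_pos hA).le,
      ← Real.rpow_mul (rdet_pos hA).le, ← Real.rpow_mul (rdet_pos hA).le]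
    congr 2
    ring

/-- Cyclic invariance replaces a non-Hermitian product by a Hermitian sandwich. -/
theorem charpoly_rpow_mul {A : Matrix (Fin n) (Fin n) ℂ} (hA : A.PosDef)
    (B : Matrix (Fin n) (Fin n) ℂ) (s : ℝ) :
    (A ^ (s / 2) * B * A ^ (s / 2)).charpoly = (A ^ s * B).charpoly := by
  rw [charpoly_mul_comm, ← Matrix.mul_assoc, rpow_mul_rpow hA, add_halves]

theorem logMaj_geomMean_of_le_half {A B : Matrix (Fin n) (Fin n) ℂ} (hA : A.PosDef)
    (hB : B.PosDef) {t : ℝ} (h0 : 0 ≤ t) (h1 : t ≤ 1 / 2) :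
    LogMaj (lam (geomMean t A B)) (lam (A ^ (1 - t) * B ^ t)) := by
  rw [← lam_congr (charpoly_rpow_mul hA (B ^ t) (1 - t))]
  have hM := posDef_geomMean hA hB t
  have hM' := posDef_conj (posDef_rpow hA ((1 - t) / 2)) (posDef_rpow hB t)
  refine ⟨⟨lam_nonneg hM, lam_nonneg hM', fun k _ hk => ?_⟩, ?_⟩
  · rw [topProd_lam_le_iff hM hk]
    have hW := posDef_conj (posDef_rpow hA (-(1 / 2))) hB
    have hc : compound k (geomMean t A B) = geomMean t (compound k A) (compound k B) := by
      rw [geomMean, compound_mul, compound_mul, compound_rpow hW, compound_mul, compound_mul,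
        compound_rpow hA, compound_rpow hA, geomMean]
    rw [hc]
    refine geomMean_le_of_le_half (posDef_compound hA) (posDef_compound hB)
      (topProd_pos (lam_pos hM') k) h0 h1 ?_
    rw [← compound_rpow hA, ← compound_rpow hB, ← compound_mul, ← compound_mul,
      ← topProd_lam_le_iff hM' hk]
  · have hW := posDef_conj (posDef_rpow hA (-(1 / 2))) hB
    rw [topProd_lam_self hM, topProd_lam_self hM', geomMean,
      rdet_conj (posDef_rpow hA _) (posDef_rpow hW t), rdet_rpow hW,
      rdet_conj (posDef_rpow hA _) hB, rdet_conj (posDef_rpow hA _) (posDef_rpow hB t),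
      rdet_rpow hA, rdet_rpow hA, rdet_rpow hA, rdet_rpow hB,
      Real.mul_rpow (sq_nonneg _) (rdet_pos hB).le,
      ← Real.rpow_natCast, ← Real.rpow_natCast, ← Real.rpow_natCast,
      ← Real.rpow_mul (rdet_pos hA).le,
      ← Real.rpow_mul (rdet_pos hA).le, ← Real.rpow_mul (rdet_pos hA).le,
      ← Real.rpow_mul (rdet_pos hA).le, ← mul_assoc, ← Real.rpow_add (rdet_pos hA)]
    congr 2
    push_cast
    ring

theorem logMaj_geomMean {A B : Matrix (Fin n) (Fin n) ℂ} (hA : A.PosDef)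
    (hB : B.PosDef) {t : ℝ} (h0 : 0 ≤ t) (h1 : t ≤ 1) :
    LogMaj (lam (geomMean t A B)) (lam (A ^ (1 - t) * B ^ t)) := by
  obtain h | h := le_total t (1 / 2)
  · exact logMaj_geomMean_of_le_half hA hB h0 h
  · have := logMaj_geomMean_of_le_half hB hA (t := 1 - t) (by linarith) (by linarith)
    rwa [← geomMean_comm hA hB, sub_sub_cancel, lam_congr (charpoly_mul_comm _ _)] at this

/-- The squares of the singular values of `A ^ s * B ^ t` are eigenvalues of a positive definite
matrix. -/
theorem decr_sing_rpow_mul_rpow {A B : Matrix (Fin n) (Fin n) ℂ} (hB : B.PosDef)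
    (s t : ℝ) : decr (sing (A ^ s * B ^ t))
      = decr (fun i => lam (A ^ s * B ^ (2 * t) * A ^ s) i ^ (1 / 2 : ℝ)) := by
  have h : (star (A ^ s * B ^ t) * (A ^ s * B ^ t)).charpoly
      = (A ^ s * B ^ (2 * t) * A ^ s).charpoly := by
    rw [star_mul, star_rpow, star_rpow, charpoly_mul_comm]
    congr 1
    rw [two_mul, ← rpow_mul_rpow hB]
    simp only [Matrix.mul_assoc]
  rw [decr_sing, lam_congr h]

theorem logMaj_sandwich {A B : Matrix (Fin n) (Fin n) ℂ} (hA : A.PosDef)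
    (hB : B.PosDef) {t : ℝ} (h0 : 0 < t) (h1 : t ≤ 1) :
    LogMaj (lam (A ^ (1 - t) * B ^ t)) (fun i => lam (sandwich t A B) i ^ t) := by
  have := logMaj_araki hA hB (s := (1 - t) / (2 * t)) h0.le h1
  rwa [show (1 - t) / (2 * t) * t = (1 - t) / 2 by field_simp,
    lam_congr (charpoly_rpow_mul hA (B ^ t) (1 - t))] at this

/-- Araki for `A` and `B ^ (2 * t)` with exponent `1 / (2 * t) ≤ 1`, then raised to the power `t`.
-/
theorem logMaj_sandwich_sing {A B : Matrix (Fin n) (Fin n) ℂ} (hA : A.PosDef)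
    (hB : B.PosDef) {t : ℝ} (h0 : 1 / 2 ≤ t) :
    LogMaj (fun i => lam (sandwich t A B) i ^ t) (sing (A ^ (1 - t) * B ^ t)) := by
  have ht : 0 < t := by linarith
  have h := (logMaj_araki hA (posDef_rpow hB (2 * t)) (s := 1 - t) (t := 1 / (2 * t))
    (by positivity) ((div_le_one (by linarith)).2 (by linarith))).rpow ht.le
  rw [rpow_rpow hB, mul_one_div_cancel (by positivity), rpow_one hB, mul_one_div] at h
  refine h.congr rfl ?_
  rw [decr_sing_rpow_mul_rpow hB]
  congr 1
  funext i
  rw [← Real.rpow_mul (lam_nonneg (posDef_conj (posDef_rpow hA _) (posDef_rpow hB _)) i)]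
  congr 1
  field_simp

/-- Now `2 * t ≤ 1` is the admissible Araki exponent, which reverses the comparison; a square root
finishes. -/
theorem logMaj_sing_sandwich {A B : Matrix (Fin n) (Fin n) ℂ} (hA : A.PosDef)
    (hB : B.PosDef) {t : ℝ} (h0 : 0 < t) (h1 : t ≤ 1 / 2) :
    LogMaj (sing (A ^ (1 - t) * B ^ t)) (fun i => lam (sandwich t A B) i ^ t) := by
  have h := (logMaj_araki hA hB (s := (1 - t) / (2 * t)) (t := 2 * t)
    (by positivity) (by linarith)).rpow (t := 1 / 2) (by norm_num)
  rw [show (1 - t) / (2 * t) * (2 * t) = 1 - t by field_simp] at h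
  refine h.congr (decr_sing_rpow_mul_rpow hB _ _).symm ?_
  congr 1
  funext i
  rw [← Real.rpow_mul (lam_nonneg (posDef_conj (posDef_rpow hA _) hB) i)]
  simp only [sandwich]
  congr 1
  ring

theorem logMaj_sing {A B : Matrix (Fin n) (Fin n) ℂ} (hA : A.PosDef)
    (hB : B.PosDef) (t : ℝ) :
    LogMaj (lam (A ^ (1 - t) * B ^ t)) (sing (A ^ (1 - t) * B ^ t)) := by
  have h := logMaj_araki hA (posDef_rpow hB (2 * t)) (s := 1 - t) (t := 1 / 2)
    (by norm_num) (by norm_num)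
  rw [rpow_rpow hB, show 2 * t * (1 / 2) = t by ring, mul_one_div,
    lam_congr (charpoly_rpow_mul hA (B ^ t) (1 - t))] at h
  exact h.congr rfl (decr_sing_rpow_mul_rpow hB _ _).symm

end LogMajorization

/-! ### Jensen's inequality for quadratic forms, weighted by squared coordinates in an eigenbasis.
-/

section QuadraticForm

variable {N : Type*} [Fintype N]

/-- The real quadratic form of a complex matrix. -/
def quadForm (C : Matrix N N ℂ) (x : N → ℂ) : ℝ := (star x ⬝ᵥ C *ᵥ x).re

theorem quadForm_mono {C D : Matrix N N ℂ} (h : C ≤ D) (x : N → ℂ) :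
    quadForm C x ≤ quadForm D x := by
  have := (Complex.nonneg_iff.1 ((Matrix.le_iff.1 h).dotProduct_mulVec_nonneg x)).1
  rw [sub_mulVec, dotProduct_sub, Complex.sub_re] at this
  exact sub_nonneg.1 this

theorem quadForm_smul_add_smul (a b : ℝ) (C D : Matrix N N ℂ) (x : N → ℂ) :
    quadForm (a • C + b • D) x = a * quadForm C x + b * quadForm D x := by
  simp only [quadForm, add_mulVec, smul_mulVec, dotProduct_add, dotProduct_smul, Complex.add_re,
    Complex.real_smul, Complex.re_ofReal_mul]

theorem quadForm_pos {C : Matrix N N ℂ} (hC : C.PosDef) {x : N → ℂ} (hx : x ≠ 0) :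
    0 < quadForm C x :=
  (Complex.pos_iff.1 (hC.dotProduct_mulVec_pos hx)).1

variable [DecidableEq N]

theorem quadForm_conjDiag (U : Matrix N N ℂ) (d : N → ℝ) (x : N → ℂ) :
    quadForm (conjDiag U d) x = ∑ i, ‖(star U *ᵥ x) i‖ ^ 2 * d i := by
  have h : star x ⬝ᵥ conjDiag U d *ᵥ x
      = star (star U *ᵥ x) ⬝ᵥ (diagonal (fun i => (d i : ℂ)) *ᵥ (star U *ᵥ x)) := by
    rw [conjDiag, ← mulVec_mulVec, ← mulVec_mulVec, dotProduct_mulVec, star_mulVec,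
      star_eq_conjTranspose, conjTranspose_conjTranspose]
  rw [quadForm, h, dotProduct, Complex.re_sum]
  refine Finset.sum_congr rfl fun i _ => ?_
  rw [mulVec_diagonal, Pi.star_apply, mul_left_comm, Complex.star_def, Complex.conj_mul',
    mul_comm, ← Complex.ofReal_pow, ← Complex.ofReal_mul, Complex.ofReal_re]

theorem sum_norm_sq_eq_quadForm_one {U : Matrix N N ℂ} (hU : U ∈ unitaryGroup N ℂ) (x : N → ℂ) :
    ∑ i, ‖(star U *ᵥ x) i‖ ^ 2 = quadForm 1 x := by
  have := quadForm_conjDiag U (fun _ => 1) x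
  rw [conjDiag_const hU, one_smul] at this
  simpa using this.symm

theorem ne_zero_of_quadForm_one {x : N → ℂ} (hx : quadForm 1 x = 1) : x ≠ 0 := by
  rintro rfl
  simp [quadForm] at hx

/-- Jensen's inequality for quadratic forms, concave powers. -/
theorem quadForm_rpow_le {C : Matrix N N ℂ} (hC : C.PosDef) {x : N → ℂ} (hx : quadForm 1 x = 1)
    {r : ℝ} (h0 : 0 ≤ r) (h1 : r ≤ 1) : quadForm (C ^ r) x ≤ quadForm C x ^ r := by
  obtain ⟨U, hU, d, hd, rfl⟩ := exists_eq_conjDiag_pos hC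
  rw [conjDiag_rpow hU hd, quadForm_conjDiag, quadForm_conjDiag]
  exact (Real.concaveOn_rpow h0 h1).le_map_sum (fun i _ => by positivity)
    ((sum_norm_sq_eq_quadForm_one hU x).trans hx) (fun i _ => (hd i).le)

/-- Jensen's inequality for quadratic forms, convex powers. -/
theorem rpow_quadForm_le {C : Matrix N N ℂ} (hC : C.PosDef) {x : N → ℂ} (hx : quadForm 1 x = 1)
    {r : ℝ} (h1 : 1 ≤ r) : quadForm C x ^ r ≤ quadForm (C ^ r) x := by
  obtain ⟨U, hU, d, hd, rfl⟩ := exists_eq_conjDiag_pos hC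
  rw [conjDiag_rpow hU hd, quadForm_conjDiag, quadForm_conjDiag]
  exact (convexOn_rpow h1).map_sum_le (fun i _ => by positivity)
    ((sum_norm_sq_eq_quadForm_one hU x).trans hx) (fun i _ => (hd i).le)

theorem inv_quadForm_le {C : Matrix N N ℂ} (hC : C.PosDef) {x : N → ℂ} (hx : quadForm 1 x = 1) :
    (quadForm C x)⁻¹ ≤ quadForm (C ^ (-1 : ℝ)) x := by
  obtain ⟨U, hU, d, hd, rfl⟩ := exists_eq_conjDiag_pos hC
  rw [conjDiag_rpow hU hd, quadForm_conjDiag, quadForm_conjDiag]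
  have := (convexOn_zpow (𝕜 := ℝ) (-1)).map_sum_le (t := Finset.univ)
    (w := fun i => ‖(star U *ᵥ x) i‖ ^ 2) (p := d) (fun i _ => by positivity)
    ((sum_norm_sq_eq_quadForm_one hU x).trans hx) (fun i _ => hd i)
  simpa [Real.rpow_neg_one] using this

theorem rpow_neg_quadForm_le {C : Matrix N N ℂ} (hC : C.PosDef) {x : N → ℂ}
    (hx : quadForm 1 x = 1) {r : ℝ} (h1 : 1 ≤ r) :
    quadForm C x ^ (-r) ≤ quadForm (C ^ (-r)) x := by
  have hpos := quadForm_pos hC (ne_zero_of_quadForm_one hx)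
  have h := rpow_quadForm_le (posDef_rpow hC (-1)) hx h1
  rw [rpow_rpow hC, neg_one_mul] at h
  refine le_trans ?_ h
  rw [Real.rpow_neg hpos.le, ← Real.inv_rpow hpos.le]
  exact Real.rpow_le_rpow (inv_nonneg.2 hpos.le) (inv_quadForm_le hC hx) (by linarith)

end QuadraticForm

/-! ### Ando's Young inequality for singular values. -/

section Young

variable {n : ℕ}

/-- A dimension count: one vector satisfying `n - 1` linear conditions. -/
theorem exists_mulVec_eq_zero_of_lt (M : Matrix (Fin n) (Fin n) ℂ) (σ τ : Equiv.Perm (Fin n))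
    (j : Fin n) : ∃ w : Fin n → ℂ, w ≠ 0 ∧ (∀ i, j < i → w (σ i) = 0) ∧
      ∀ i, i < j → (M *ᵥ w) (τ i) = 0 := by
  let Φ : (Fin n → ℂ) →ₗ[ℂ] ({i : Fin n // i ≠ j} → ℂ) :=
    LinearMap.pi fun i => if j < i.1 then LinearMap.proj (σ i.1)
      else (LinearMap.proj (τ i.1)).comp M.mulVecLin
  have hlt : Module.finrank ℂ ({i : Fin n // i ≠ j} → ℂ) < Module.finrank ℂ (Fin n → ℂ) := by
    rw [Module.finrank_fintype_fun_eq_card, Module.finrank_fintype_fun_eq_card]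
    exact Fintype.card_subtype_lt (x := j) (by simp)
  obtain ⟨w, hw, hw0⟩ := Submodule.exists_mem_ne_zero_of_ne_bot
    (LinearMap.ker_ne_bot_of_finrank_lt (f := Φ) hlt)
  refine ⟨w, hw0, fun i hi => ?_, fun i hi => ?_⟩
  · have := congrFun (LinearMap.mem_ker.1 hw) ⟨i, hi.ne'⟩
    simpa [Φ, hi] using this
  · have := congrFun (LinearMap.mem_ker.1 hw) ⟨i, hi.ne⟩
    simpa [Φ, hi.le.not_gt] using this

theorem sqrt_le_of_young {a b c m s t : ℝ} (ha : 0 < a) (hb : 0 < b) (hc : 0 < c) (hm : 0 < m)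
    (hcb : c ≤ b) (hs : 0 ≤ s) (ht : 0 ≤ t) (hst : s + t = 1)
    (h : m * c ^ (-(2 * t)) ≤ a ^ (2 * s)) : m ^ (1 / 2 : ℝ) ≤ s * a + t * b := by
  have h1 : m ≤ (a ^ s * b ^ t) ^ (2 : ℝ) := by
    have hcp : 0 < c ^ (2 * t) := Real.rpow_pos_of_pos hc _
    rw [Real.rpow_neg hc.le, ← div_eq_mul_inv, div_le_iff₀ hcp] at h
    refine h.trans ?_
    rw [Real.mul_rpow (by positivity) (by positivity), ← Real.rpow_mul ha.le,
      ← Real.rpow_mul hb.le, mul_comm s, mul_comm t]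
    have := Real.rpow_le_rpow hc.le hcb (show 0 ≤ 2 * t by linarith)
    gcongr
  calc m ^ (1 / 2 : ℝ) ≤ ((a ^ s * b ^ t) ^ (2 : ℝ)) ^ (1 / 2 : ℝ) :=
        Real.rpow_le_rpow hm.le h1 (by norm_num)
    _ = a ^ s * b ^ t := by
        rw [← Real.rpow_mul (by positivity)]
        norm_num
    _ ≤ s * a + t * b := Real.geom_mean_le_arith_mean2_weighted hs ht ha.le hb.le hst

/-- Ando's matrix Young inequality. -/
theorem decrLE_young {A B : Matrix (Fin n) (Fin n) ℂ} (hA : A.PosDef) (hB : B.PosDef) {t : ℝ}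
    (h0 : 1 / 2 ≤ t) (h1 : t ≤ 1) :
    DecrLE (sing (A ^ (1 - t) * B ^ t)) (lam ((1 - t) • A + t • B)) := by
  intro j
  set s := 1 - t with hs
  have hs0 : 0 ≤ s := by linarith
  have ht0 : 0 < t := by linarith
  have hS := posDef_conj (posDef_rpow hA s) (posDef_rpow hB (2 * t))
  have hH : (s • A + t • B).PosDef := (hB.smul ht0).posSemidef_add (hA.posSemidef.smul hs0)
  rw [decr_sing_rpow_mul_rpow hB, decr_rpow (lam_nonneg hS) (by norm_num)]
  obtain ⟨U, hU, d, hd, hSU⟩ := exists_eq_conjDiag_pos hS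
  obtain ⟨V, hV, e, he, hHV⟩ := exists_eq_conjDiag_pos hH
  rw [hSU, hHV, decr_congr (lam_map_conjDiag hU d), decr_congr (lam_map_conjDiag hV e)]
  obtain ⟨σ, hσ⟩ := decr_perm d
  obtain ⟨τ, hτ⟩ := decr_perm e
  set m := decr d j with hm
  have hmpos : 0 < m := by rw [hm, hσ]; exact hd _
  -- The vector `U *ᵥ w₀` lies in the span of eigenvectors for the `j + 1` largest eigenvalues of
  -- the sandwich, while `A ^ (-s) *ᵥ (U *ᵥ w₀)` is orthogonal to the first `j` eigenvectors of the
  -- arithmetic mean.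
  obtain ⟨w₀, hw₀, hσw₀, hτw₀⟩ := exists_mulVec_eq_zero_of_lt (star V * A ^ (-s) * U) σ τ j
  have hinj : Function.Injective ((A ^ (-s) * U) *ᵥ ·) :=
    mulVec_injective_of_isUnit ((posDef_rpow hA _).isUnit.mul
      ⟨⟨U, star U, mem_unitaryGroup_iff.1 hU, mem_unitaryGroup_iff'.1 hU⟩, rfl⟩)
  -- normalize so that `(A ^ (-s) * U) *ᵥ w` is a unit vector
  obtain ⟨w, hσw, hτw, hx⟩ : ∃ w : Fin n → ℂ, (∀ i, j < i → w (σ i) = 0) ∧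
      (∀ i, i < j → ((star V * A ^ (-s) * U) *ᵥ w) (τ i) = 0) ∧
      quadForm 1 ((A ^ (-s) * U) *ᵥ w) = 1 := by
    have hx₀ : (A ^ (-s) * U) *ᵥ w₀ ≠ 0 := fun h =>
      hw₀ (hinj (h.trans (mulVec_zero _).symm))
    have hq := quadForm_pos PosDef.one hx₀
    set q := quadForm 1 ((A ^ (-s) * U) *ᵥ w₀) with hqdef
    refine ⟨((√q)⁻¹ : ℝ) • w₀, fun i hi => by simp [hσw₀ i hi],
      fun i hi => by simp [mulVec_smul, hτw₀ i hi], ?_⟩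
    have : ∀ (r : ℝ) (x : Fin n → ℂ), quadForm 1 (r • x) = r ^ 2 * quadForm 1 x := by
      intro r x
      simp only [quadForm, one_mulVec, star_smul, star_trivial, smul_dotProduct, dotProduct_smul,
        Complex.real_smul, Complex.re_ofReal_mul]
      ring
    rw [mulVec_smul, this, ← hqdef, inv_pow, Real.sq_sqrt hq.le, inv_mul_cancel₀ hq.ne']
  set x := (A ^ (-s) * U) *ᵥ w with hxdef
  have hx0 := ne_zero_of_quadForm_one hx
  -- Truncating the spectrum at `m` keeps `P` below the sandwich and makes `U *ᵥ w` an exact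
  -- eigenvector for `m`.
  set P := conjDiag U (fun i => min (d i) m) with hP
  have hPw : P *ᵥ (U *ᵥ w) = (m : ℂ) • (U *ᵥ w) := by
    have hd' : diagonal (fun i => ((min (d i) m : ℝ) : ℂ)) *ᵥ w = (m : ℂ) • w := by
      funext i
      rw [mulVec_diagonal, Pi.smul_apply, smul_eq_mul]
      obtain ⟨i, rfl⟩ := σ.surjective i
      obtain hi | hi := lt_or_ge j i
      · simp [hσw i hi]
      · have : m ≤ d (σ i) := by
          have := decr_antitone d hi
          rwa [← hm, hσ] at this
        rw [min_eq_right this]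
    calc P *ᵥ (U *ᵥ w) = U *ᵥ (diagonal (fun i => ((min (d i) m : ℝ) : ℂ)) *ᵥ
          ((star U * U) *ᵥ w)) := by simp only [hP, conjDiag, mulVec_mulVec, Matrix.mul_assoc]
      _ = _ := by rw [mem_unitaryGroup_iff'.1 hU, one_mulVec, hd', mulVec_smul]
  have hPp : P.PosDef := (posDef_conjDiag_iff hU _).2 fun i => lt_min (hd i) hmpos
  set T := A ^ (-s) * P * A ^ (-s) with hT
  have hTp : T.PosDef := posDef_conj (posDef_rpow hA _) hPp
  -- Löwner-Heinz with exponent `1 / (2 * t)`; this needs `t ≥ 1/2`.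
  have hTB : T ^ (1 / (2 * t)) ≤ B := by
    have hPS : P ≤ A ^ s * B ^ (2 * t) * A ^ s := by
      rw [hSU, hP, conjDiag_le_iff hU]
      exact fun i => min_le_left _ _
    have h2 := conj_le_conj (star_rpow A (-s)) hPS
    rw [conj_neg_conj hA] at h2
    have h3 := rpow_le_rpow h2 (t := 1 / (2 * t)) (by positivity)
      ((div_le_one (by linarith)).2 (by linarith))
    rwa [rpow_rpow hB, mul_one_div_cancel (by positivity), rpow_one hB] at h3
  -- The eigenvector relation becomes `A ^ (2 * s) x = m T⁻¹ x`, linking the forms of `A` and `T`.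
  have hTx : m * quadForm (T ^ (-1 : ℝ)) x = quadForm (A ^ (2 * s)) x := by
    have h2 : T *ᵥ (A ^ (2 * s) *ᵥ x) = (m : ℂ) • x := by
      calc T *ᵥ (A ^ (2 * s) *ᵥ x)
          = A ^ (-s) *ᵥ (P *ᵥ ((A ^ (-s) * A ^ (2 * s) * A ^ (-s)) *ᵥ (U *ᵥ w))) := by
            simp only [hT, hxdef, mulVec_mulVec, Matrix.mul_assoc]
        _ = (m : ℂ) • x := by
            rw [rpow_mul_rpow_mul_rpow hA, show -s + 2 * s + -s = 0 by ring, rpow_zero hA,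
              one_mulVec, hPw, mulVec_smul, hxdef, mulVec_mulVec]
    have h3 : A ^ (2 * s) *ᵥ x = (m : ℂ) • (T ^ (-1 : ℝ) *ᵥ x) := by
      have hT1 : T ^ (-1 : ℝ) * T = 1 := by
        nth_rewrite 2 [← rpow_one hTp]
        rw [rpow_mul_rpow hTp, neg_add_cancel, rpow_zero hTp]
      calc A ^ (2 * s) *ᵥ x = (T ^ (-1 : ℝ) * T) *ᵥ (A ^ (2 * s) *ᵥ x) := by
            rw [hT1, one_mulVec]
        _ = T ^ (-1 : ℝ) *ᵥ (T *ᵥ (A ^ (2 * s) *ᵥ x)) := (mulVec_mulVec _ _ _).symm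
        _ = _ := by rw [h2, mulVec_smul]
    rw [quadForm, quadForm, h3, dotProduct_smul, smul_eq_mul, Complex.re_ofReal_mul]
  set C := T ^ (1 / (2 * t)) with hC
  have hCp : C.PosDef := posDef_rpow hTp _
  have hCT : C ^ (-(2 * t)) = T ^ (-1 : ℝ) := by
    rw [hC, rpow_rpow hTp]
    congr 1
    field_simp
  have hJ := rpow_neg_quadForm_le hCp hx (r := 2 * t) (by linarith)
  rw [hCT] at hJ
  have hmain : m ^ (1 / 2 : ℝ) ≤ quadForm (s • A + t • B) x := by
    rw [quadForm_smul_add_smul]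
    refine sqrt_le_of_young (quadForm_pos hA hx0) (quadForm_pos hB hx0) (quadForm_pos hCp hx0) hmpos
      (quadForm_mono hTB x) hs0 ht0.le (by rw [hs]; ring) ?_
    calc m * quadForm C x ^ (-(2 * t)) ≤ m * quadForm (T ^ (-1 : ℝ)) x :=
          mul_le_mul_of_nonneg_left hJ hmpos.le
      _ = quadForm (A ^ (2 * s)) x := hTx
      _ ≤ quadForm A x ^ (2 * s) := quadForm_rpow_le hA hx (by linarith) (by linarith)
  refine hmain.trans ?_
  rw [hHV, quadForm_conjDiag]
  calc ∑ i, ‖(star V *ᵥ x) i‖ ^ 2 * e i ≤ ∑ i, ‖(star V *ᵥ x) i‖ ^ 2 * decr e j := by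
        refine Finset.sum_le_sum fun i _ => ?_
        obtain ⟨i, rfl⟩ := τ.surjective i
        obtain hi | hi := lt_or_ge i j
        · have : (star V *ᵥ x) (τ i) = 0 := by
            rw [← hτw i hi, hxdef, mulVec_mulVec, Matrix.mul_assoc]
          simp [this]
        · have : e (τ i) ≤ decr e j := by
            have := decr_antitone e hi
            rwa [hτ] at this ⊢
          gcongr
    _ = decr e j := by
        rw [← Finset.sum_mul, sum_norm_sq_eq_quadForm_one hV, hx, one_mul]

end Young

/-! ### The sandwiched term as `t → 0+`. -/

section Limit

variable {n : ℕ}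

theorem continuous_rpow_exponent {A : Matrix (Fin n) (Fin n) ℂ} (hA : A.PosDef) :
    Continuous fun t : ℝ => A ^ t := by
  obtain ⟨U, hU, d, hd, rfl⟩ := exists_eq_conjDiag_pos hA
  simp_rw [conjDiag_rpow hU hd]
  have : ∀ i, Continuous fun t : ℝ => d i ^ t := fun i => Real.continuous_const_rpow (hd i).ne'
  unfold conjDiag
  have hc : Continuous fun t : ℝ => fun i => ((d i ^ t : ℝ) : ℂ) :=
    continuous_pi fun i => Complex.continuous_ofReal.comp (this i)
  exact (continuous_const.matrix_mul hc.matrix_diagonal).matrix_mul continuous_const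

/-- The squeeze theorem for the Loewner order. -/
theorem tendsto_of_le_of_le {ι : Type*} {l : Filter ι} {f g h : ι → Matrix (Fin n) (Fin n) ℂ}
    {G : Matrix (Fin n) (Fin n) ℂ} (hf : Filter.Tendsto f l (𝓝 G))
    (hh : Filter.Tendsto h l (𝓝 G)) (hfg : ∀ᶠ t in l, f t ≤ g t) (hgh : ∀ᶠ t in l, g t ≤ h t) :
    Filter.Tendsto g l (𝓝 G) := by
  open scoped Matrix.Norms.L2Operator in
  have h1 : Filter.Tendsto (fun t => h t - f t) l (𝓝 0) := by simpa using hh.sub hf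
  have h2 : Filter.Tendsto (fun t => g t - f t) l (𝓝 0) := by
    refine squeeze_zero_norm' ?_ (tendsto_zero_iff_norm_tendsto_zero.1 h1)
    filter_upwards [hfg, hgh] with t ht1 ht2
    exact CStarAlgebra.norm_le_norm_of_nonneg_of_le (sub_nonneg.2 ht1) (sub_le_sub_right ht2 _)
  simpa using h2.add hf

theorem exists_smul_one_le_le_smul_one {B : Matrix (Fin n) (Fin n) ℂ} (hB : B.PosDef) :
    ∃ m M : ℝ, 0 < m ∧ 0 < M ∧ m • 1 ≤ B ∧ B ≤ M • 1 := by
  obtain ⟨U, hU, d, hd, rfl⟩ := exists_eq_conjDiag_pos hB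
  have hbd : ∀ f : Fin n → ℝ, ∃ M : ℝ, 0 < M ∧ ∀ i, f i ≤ M := fun f => by
    obtain ⟨M, hM⟩ := (Set.finite_range f).bddAbove
    exact ⟨max M 1, by positivity, fun i => le_max_of_le_left (hM ⟨i, rfl⟩)⟩
  obtain ⟨M, hM0, hM⟩ := hbd d
  obtain ⟨K, hK0, hK⟩ := hbd fun i => (d i)⁻¹
  exact ⟨K⁻¹, M, inv_pos.2 hK0, hM0,
    (smul_one_le_conjDiag_iff hU d _).2 fun i => inv_le_of_inv_le₀ (hd i) (hK i),
    (conjDiag_le_smul_one_iff hU d _).2 hM⟩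

/-- The sandwiched powers converge to `A`, whatever `B` is. -/
theorem tendsto_sandwich_rpow {A B : Matrix (Fin n) (Fin n) ℂ} (hA : A.PosDef) (hB : B.PosDef) :
    Filter.Tendsto (fun t : ℝ => sandwich t A B ^ t) (𝓝[>] (0 : ℝ)) (𝓝 A) := by
  obtain ⟨m, M, hm, hM, hmB, hBM⟩ := exists_smul_one_le_le_smul_one hB
  have hlim : ∀ c : ℝ, 0 < c →
      Filter.Tendsto (fun t : ℝ => c ^ t • A ^ (1 - t)) (𝓝[>] (0 : ℝ)) (𝓝 A) := fun c hc => by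
    have hcont : Continuous fun t : ℝ => c ^ t • A ^ (1 - t) :=
      (Real.continuous_const_rpow hc.ne').smul
        ((continuous_rpow_exponent hA).comp (continuous_const.sub continuous_id))
    have := (hcont.tendsto 0).mono_left (nhdsWithin_le_nhds (s := Set.Ioi 0))
    simpa [rpow_one hA] using this
  -- For scalar `B` the sandwiched power is explicit, which provides both squeezing bounds.
  have hconj : ∀ (c t : ℝ), 0 < c → 0 < t →
      (A ^ ((1 - t) / (2 * t)) * (c • 1) * A ^ ((1 - t) / (2 * t))) ^ t = c ^ t • A ^ (1 - t) :=
    fun c t hc ht => by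
      rw [Matrix.mul_smul, Matrix.smul_mul, Matrix.mul_one, rpow_mul_rpow hA,
        smul_rpow (posDef_rpow hA _) hc, rpow_rpow hA]
      congr 2
      field_simp
      ring
  have hev : ∀ᶠ t : ℝ in 𝓝[>] (0 : ℝ), 0 < t ∧ t ≤ 1 := by
    filter_upwards [self_mem_nhdsWithin, nhdsWithin_le_nhds (Iic_mem_nhds one_pos)] with t h1 h2
    exact ⟨h1, h2⟩
  refine tendsto_of_le_of_le (hlim m hm) (hlim M hM) ?_ ?_
  · filter_upwards [hev] with t ht
    rw [← hconj m t hm ht.1]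
    exact rpow_le_rpow (conj_le_conj (star_rpow _ _) hmB) ht.1.le ht.2
  · filter_upwards [hev] with t ht
    rw [← hconj M t hM ht.1]
    exact rpow_le_rpow (conj_le_conj (star_rpow _ _) hBM) ht.1.le ht.2

theorem decr_sing_of_posDef {A : Matrix (Fin n) (Fin n) ℂ} (hA : A.PosDef) :
    decr (sing A) = decr (lam A) := by
  rw [decr_sing]
  obtain ⟨U, hU, d, hd, rfl⟩ := exists_eq_conjDiag_pos hA
  rw [hA.isHermitian.isSelfAdjoint.star_eq, conjDiag_mul hU]
  refine decr_congr ?_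
  have := congrArg (Multiset.map fun a : ℝ => a ^ (1 / 2 : ℝ))
    (lam_map_conjDiag hU fun i => d i * d i)
  rw [Multiset.map_map, Multiset.map_map] at this
  rw [lam_map_conjDiag hU]
  refine this.trans ?_
  congr 1
  funext i
  rw [Function.comp_apply, ← Real.sqrt_eq_rpow, Real.sqrt_mul_self (hd i).le]

theorem LogMaj.refl {x : Fin n → ℝ} (hx : ∀ i, 0 ≤ x i) : LogMaj x x :=
  ⟨⟨hx, hx, fun _ _ _ => le_rfl⟩, rfl⟩

end Limit

end MatrixChain

theorem mainTheorem10 (n : ℕ) (A B : Matrix (Fin n) (Fin n) ℂ) (hA : A.PosDef) (hB : B.PosDef) :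
    -- all the eigenvalue tuples below consist of positive real numbers
    (∀ t : ℝ, 0 ≤ t → t ≤ 1 →
      MatrixChain.HasPosEig (MatrixChain.gmean t A B) ∧
      MatrixChain.HasPosEig (A ^ (1 - t) * B ^ t) ∧
      (0 < t → MatrixChain.HasPosEig (MatrixChain.sandwich t A B)) ∧
      MatrixChain.HasPosEig ((1 - t) • A + t • B)) ∧
    -- the chain for 1/2 ≤ t ≤ 1
    (∀ t : ℝ, 1 / 2 ≤ t → t ≤ 1 →
      MatrixChain.LogMaj (MatrixChain.lam (MatrixChain.gmean t A B))
        (MatrixChain.lam (A ^ (1 - t) * B ^ t)) ∧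
      MatrixChain.LogMaj (MatrixChain.lam (A ^ (1 - t) * B ^ t))
        (fun i => MatrixChain.lam (MatrixChain.sandwich t A B) i ^ t) ∧
      MatrixChain.LogMaj (fun i => MatrixChain.lam (MatrixChain.sandwich t A B) i ^ t)
        (MatrixChain.sing (A ^ (1 - t) * B ^ t)) ∧
      MatrixChain.DecrLE (MatrixChain.sing (A ^ (1 - t) * B ^ t))
        (MatrixChain.lam ((1 - t) • A + t • B))) ∧
    -- the chain for 0 ≤ t ≤ 1/2, the sandwiched term being given by its formula for t > 0
    (∀ t : ℝ, 0 ≤ t → t ≤ 1 / 2 →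
      MatrixChain.LogMaj (MatrixChain.lam (MatrixChain.gmean t A B))
        (MatrixChain.lam (A ^ (1 - t) * B ^ t)) ∧
      MatrixChain.LogMaj (MatrixChain.lam (A ^ (1 - t) * B ^ t))
        (MatrixChain.sing (A ^ (1 - t) * B ^ t)) ∧
      (0 < t → MatrixChain.LogMaj (MatrixChain.sing (A ^ (1 - t) * B ^ t))
        (fun i => MatrixChain.lam (MatrixChain.sandwich t A B) i ^ t))) ∧
    -- the last relation at t = 0, the sandwiched term being its limit as t → 0+
    (∃ G : Matrix (Fin n) (Fin n) ℂ,
      Filter.Tendsto (fun t : ℝ => MatrixChain.sandwich t A B ^ t) (𝓝[>] (0 : ℝ)) (𝓝 G) ∧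
      MatrixChain.HasPosEig G ∧
      MatrixChain.LogMaj (MatrixChain.sing (A ^ (1 - 0 : ℝ) * B ^ (0 : ℝ)))
        (MatrixChain.lam G)) := by
  have hHP : ∀ t : ℝ, 0 ≤ t → t ≤ 1 → ((1 - t) • A + t • B).PosDef := fun t h0 h1 => by
    obtain rfl | h0' := h0.eq_or_lt
    · simpa using hA
    · exact (hB.smul h0').posSemidef_add (hA.posSemidef.smul (sub_nonneg.2 h1))
  -- On `Fin n`, `geomMean` unfolds to `gmean`; the general index type was needed for compounds.
  refine ⟨fun t h0 h1 =>
      ⟨MatrixChain.hasPosEig_of_posDef (MatrixChain.posDef_geomMean hA hB t), ?_,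
        fun ht => MatrixChain.hasPosEig_of_posDef
          (MatrixChain.posDef_conj (MatrixChain.posDef_rpow hA _) hB),
        MatrixChain.hasPosEig_of_posDef (hHP t h0 h1)⟩,
    fun t h0 h1 => ?_, fun t h0 h1 => ?_, A, MatrixChain.tendsto_sandwich_rpow hA hB,
    MatrixChain.hasPosEig_of_posDef hA, ?_⟩
  · have hM := MatrixChain.posDef_conj (MatrixChain.posDef_rpow hA ((1 - t) / 2))
      (MatrixChain.posDef_rpow hB t)
    exact (MatrixChain.hasPosEig_of_posDef hM).congr
      (MatrixChain.charpoly_rpow_mul hA (B ^ t) (1 - t))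
  · have ht : 0 < t := by linarith
    exact ⟨MatrixChain.logMaj_geomMean hA hB ht.le h1, MatrixChain.logMaj_sandwich hA hB ht h1,
      MatrixChain.logMaj_sandwich_sing hA hB h0, MatrixChain.decrLE_young hA hB h0 h1⟩
  · exact ⟨MatrixChain.logMaj_geomMean hA hB h0 (by linarith), MatrixChain.logMaj_sing hA hB t,
      fun ht => MatrixChain.logMaj_sing_sandwich hA hB ht h1⟩
  -- The limit is `A`, so the relation is reflexivity: singular values and eigenvalues of `A`
  -- coincide up to order.
  · rw [sub_zero, MatrixChain.rpow_one hA, MatrixChain.rpow_zero hB, Matrix.mul_one]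
    exact (MatrixChain.LogMaj.refl (MatrixChain.lam_nonneg hA)).congr
      (MatrixChain.decr_sing_of_posDef hA).symm rfl
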